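/- Let $n$ be a natural number. For a finite index set $I$ let $\mathcal F(\mathbb C^{I})$ be the Segal–Bargmann space of holomorphic functions $F:\mathbb C^{I}\to\mathbb C$ with $\int_{\mathbb C^{I}}|F(z)|^2e^{-|z|^2}\,dz<\infty$, with inner product $\langle F,G\rangle=\pi^{-|I|}\int_{\mathbb C^{I}}\overline{F(z)}\,G(z)\,e^{-|z|^2}\,dz$, where $|z|^2=\sum_{i\in I}|z_i|^2$. Let $\mathcal F(\mathbb C^{n\times n})^U$ be the subspace of those $F\in\mathcal F(\mathbb C^{n\times n})$ with $F(u^{-1}zu)=F(z)$ for all $z\in\mathbb C^{n\times n}$ and all unitary $n\times n$ matrices $u$, and let $\mathcal F(\mathbb C^{n})_{\mathrm{alt}}$ be the subspace of those $F\in\mathcal F(\mathbb C^n)$ with $F(z_1,\dots,z_n)=\operatorname{sgn}(\sigma)F(z_{\sigma^{-1}(1)},\dots,z_{\sigma^{-1}(n)})$ for all $\sigma\in S_n$. Put $\Delta(x)=\prod_{i<j}(x_j-x_i)$ and $c=\left(\prod_{p=1}^n p!\right)^{-1/2}$. Identify the set $D$ of complex diagonal $n\times n$ matrices with $\mathbb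 C^n$, and write $F|_D$ for the restriction of $F$ to $D$. For a polynomial $F$, let $F(\partial)$ be the differential operator obtained by replacing every variable of $F$ (that is, $z_{ij}$ on $\mathbb C^{n\times n}$ and $z_i$ on $\mathbb C^n$) by the partial derivative with respect to that variable. Then the following are equivalent: 1. The map $\psi(F)(x)=c\,\Delta(x)\,F|_D(x)$, $x\in D$, is a well-defined unitary map from $\mathcal F(\mathbb C^{n\times n})^U$ onto $\mathcal F(\mathbb C^n)_{\mathrm{alt}}$; that is, it maps the first space bijectively onto the second and preserves inner products. 2. For all polynomials $F,G\in\mathcal F(\mathbb C^{n\times n})^U$ and all $x\in D$, $$\Delta(x)\cdot\bigl(F(\partial)G\bigr)(x)=\Bigl(F|_D(\partial)\bigl(\Delta\cdot G|_D\bigr)\Bigr)(x).$$ -/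

import Mathlib

open MeasureTheory
open scoped Nat

noncomputable section

/-! ### Segal-Bargmann spaces -/

/-- The Segal-Bargmann space of the coordinate space `ι → ℂ`: the entire functions `F` with
`∫ |F(z)|² exp(-∑ |zᵢ|²) dz < ∞`. -/
def segalBargmann (ι : Type) [Fintype ι] : Submodule ℂ ((ι → ℂ) → ℂ) where
  carrier := {F | Differentiable ℂ F ∧
    Integrable (fun z : ι → ℂ => ‖F z‖ ^ 2 * Real.exp (-∑ i, ‖z i‖ ^ 2)) volume}
  zero_mem' := by
    refine ⟨differentiable_const 0, ?_⟩
    simp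
  add_mem' := by
    rintro F G ⟨hF, hFi⟩ ⟨hG, hGi⟩
    refine ⟨hF.add hG, ?_⟩
    refine ((hFi.add hGi).const_mul 2).mono' ?_ ?_
    · have h1 : Continuous (F + G) := hF.continuous.add hG.continuous
      have h2 : Continuous fun z : ι → ℂ =>
          ‖(F + G) z‖ ^ 2 * Real.exp (-∑ i, ‖z i‖ ^ 2) := by fun_prop
      exact h2.aestronglyMeasurable
    · refine Filter.Eventually.of_forall fun z => ?_
      have h1 : ‖F z + G z‖ ≤ ‖F z‖ + ‖G z‖ := norm_add_le _ _
      have h2 : ‖F z + G z‖ ^ 2 ≤ 2 * (‖F z‖ ^ 2 + ‖G z‖ ^ 2) := by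
        nlinarith [sq_nonneg (‖F z‖ - ‖G z‖), norm_nonneg (F z + G z)]
      have h3 : 0 ≤ Real.exp (-∑ i, ‖z i‖ ^ 2) := (Real.exp_pos _).le
      rw [Real.norm_of_nonneg (by positivity)]
      simp only [Pi.add_apply]
      nlinarith [mul_le_mul_of_nonneg_right h2 h3]
  smul_mem' := by
    rintro a F ⟨hF, hFi⟩
    refine ⟨hF.const_smul a, ?_⟩
    refine (hFi.const_mul (‖a‖ ^ 2)).congr (Filter.Eventually.of_forall fun z => ?_)
    simp only [Pi.smul_apply, smul_eq_mul, norm_mul]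
    ring

/-- The inner product `⟨F, G⟩ = π^{-N} ∫ conj(F(z)) G(z) exp(-∑ |zᵢ|²) dz` with `N = |ι|`,
conjugate linear in the first variable. -/
def sbInner {ι : Type} [Fintype ι] (F G : (ι → ℂ) → ℂ) : ℂ :=
  ((Real.pi : ℂ) ^ Fintype.card ι)⁻¹ *
    ∫ z : ι → ℂ, starRingEnd ℂ (F z) * G z * (Real.exp (-∑ i, ‖z i‖ ^ 2) : ℂ)

/-- The coordinates `(i, j) ↦ A i j` of a matrix: `ℂ^{n×n}` is coordinatised by
`Fin n × Fin n → ℂ`. -/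
def entries {n : ℕ} (A : Matrix (Fin n) (Fin n) ℂ) : Fin n × Fin n → ℂ := fun p => A p.1 p.2

/-- The members of the Segal-Bargmann space of `ℂ^{n×n}` that are invariant under conjugation
by unitary matrices. -/
def invariantSB (n : ℕ) : Submodule ℂ ((Fin n × Fin n → ℂ) → ℂ) where
  carrier := {F | F ∈ segalBargmann (Fin n × Fin n) ∧
    ∀ (u : Matrix.unitaryGroup (Fin n) ℂ) (A : Matrix (Fin n) (Fin n) ℂ),
      F (entries A) =
        F (entries ((↑(u⁻¹) : Matrix (Fin n) (Fin n) ℂ) * A *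
          (u : Matrix (Fin n) (Fin n) ℂ)))}
  zero_mem' := ⟨Submodule.zero_mem _, fun _ _ => rfl⟩
  add_mem' := by
    rintro F G ⟨hF, hF'⟩ ⟨hG, hG'⟩
    exact ⟨Submodule.add_mem _ hF hG, fun u A => congrArg₂ (· + ·) (hF' u A) (hG' u A)⟩
  smul_mem' := by
    rintro a F ⟨hF, hF'⟩
    exact ⟨Submodule.smul_mem _ a hF, fun u A => congrArg (a • ·) (hF' u A)⟩

/-- The alternating members of the Segal-Bargmann space of `ℂⁿ`. -/
def alternatingSB (n : ℕ) : Submodule ℂ ((Fin n → ℂ) → ℂ) where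
  carrier := {F | F ∈ segalBargmann (Fin n) ∧
    ∀ (σ : Equiv.Perm (Fin n)) (z : Fin n → ℂ),
      F z = ((Equiv.Perm.sign σ : ℤ) : ℂ) * F (fun i => z (σ⁻¹ i))}
  zero_mem' := ⟨Submodule.zero_mem _, fun _ _ => by simp⟩
  add_mem' := by
    rintro F G ⟨hF, hF'⟩ ⟨hG, hG'⟩
    refine ⟨Submodule.add_mem _ hF hG, fun σ z => ?_⟩
    rw [Pi.add_apply, Pi.add_apply, hF' σ z, hG' σ z, mul_add]
  smul_mem' := by
    rintro a F ⟨hF, hF'⟩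
    refine ⟨Submodule.smul_mem _ a hF, fun σ z => ?_⟩
    rw [Pi.smul_apply, Pi.smul_apply, hF' σ z, smul_eq_mul, smul_eq_mul, mul_left_comm]

/-! ### The canonical map -/

/-- The Vandermonde product `Δ(v) = ∏_{i < j} (vⱼ - vᵢ)`, over any commutative ring. -/
def vandermondeProd {R : Type*} [CommRing R] {n : ℕ} (v : Fin n → R) : R :=
  ∏ i : Fin n, ∏ j ∈ Finset.Ioi i, (v j - v i)

/-- The constant `c = (∏_{p=1}^n p!)^{-1/2}`. -/
def hcConst (n : ℕ) : ℝ := (Real.sqrt (∏ p ∈ Finset.Icc 1 n, (p ! : ℝ)))⁻¹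

/-- The linear map `ψ(F)(x) = c Δ(x) F(diag(x))`. -/
def psi (n : ℕ) : ((Fin n × Fin n → ℂ) → ℂ) →ₗ[ℂ] ((Fin n → ℂ) → ℂ) where
  toFun F := fun x => (hcConst n : ℂ) * vandermondeProd x * F (entries (Matrix.diagonal x))
  map_add' F G := by
    funext x
    simp only [Pi.add_apply]
    ring
  map_smul' a F := by
    funext x
    simp only [Pi.smul_apply, smul_eq_mul, RingHom.id_apply]
    ring

/-- A linear map `T` of function spaces restricts to a well defined unitary map from `S` onto
`S'`: it maps `S` bijectively onto `S'` and preserves the inner product. -/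
def IsUnitaryBetween {ι κ : Type} [Fintype ι] [Fintype κ]
    (T : ((ι → ℂ) → ℂ) →ₗ[ℂ] ((κ → ℂ) → ℂ))
    (S : Submodule ℂ ((ι → ℂ) → ℂ)) (S' : Submodule ℂ ((κ → ℂ) → ℂ)) : Prop :=
  Set.BijOn T S S' ∧ ∀ F ∈ S, ∀ G ∈ S, sbInner (T F) (T G) = sbInner F G

/-! ### Polynomial differential operators -/

/-- Partial derivatives of polynomials commute. -/
theorem pderiv_commute {ι : Type} (i j : ι) :
    Commute ((MvPolynomial.pderiv i).toLinearMap : Module.End ℂ (MvPolynomial ι ℂ))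
      (MvPolynomial.pderiv j).toLinearMap := by
  classical
  have h : ⁅(MvPolynomial.pderiv i : Derivation ℂ (MvPolynomial ι ℂ) (MvPolynomial ι ℂ)),
      (MvPolynomial.pderiv j : Derivation ℂ (MvPolynomial ι ℂ) (MvPolynomial ι ℂ))⁆ = 0 := by
    apply MvPolynomial.derivation_ext
    intro k
    rw [Derivation.commutator_apply]
    simp only [MvPolynomial.pderiv_X, Pi.single_apply]
    split_ifs <;> simp
  refine LinearMap.ext fun p => ?_
  have hp := congrArg (fun D => D p) h
  simp only [Derivation.commutator_apply, Derivation.coe_zero, Pi.zero_apply] at hp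
  exact sub_eq_zero.mp hp

theorem pairwise_commute_pderiv_pow {ι : Type} [Fintype ι] (μ : ι →₀ ℕ) :
    ((Finset.univ : Finset ι) : Set ι).Pairwise (Function.onFun Commute fun i =>
      ((MvPolynomial.pderiv i).toLinearMap : Module.End ℂ (MvPolynomial ι ℂ)) ^ μ i) :=
  fun i _ j _ _ => (pderiv_commute i j).pow_pow (μ i) (μ j)

/-- The iterated partial derivative `∂^μ = ∏ᵢ (∂/∂zᵢ)^{μᵢ}` of polynomials. -/
def iteratedPderiv {ι : Type} [Fintype ι] (μ : ι →₀ ℕ) : Module.End ℂ (MvPolynomial ι ℂ) :=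
  Finset.univ.noncommProd
    (fun i => ((MvPolynomial.pderiv i).toLinearMap : Module.End ℂ (MvPolynomial ι ℂ)) ^ μ i)
    (pairwise_commute_pderiv_pow μ)

/-- The constant coefficient differential operator `F(∂)`: each variable `zᵢ` of the polynomial
`F` is replaced by `∂/∂zᵢ`. -/
def diffOp {ι : Type} [Fintype ι] (F : MvPolynomial ι ℂ) : Module.End ℂ (MvPolynomial ι ℂ) :=
  ∑ μ ∈ F.support, F.coeff μ • iteratedPderiv μ

/-- The restriction `F|_D` of a polynomial in the matrix entries to the diagonal matrices, as a
polynomial in the `n` diagonal entries. -/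
def restrictDiag {n : ℕ} (F : MvPolynomial (Fin n × Fin n) ℂ) : MvPolynomial (Fin n) ℂ :=
  MvPolynomial.aeval (fun p => if p.1 = p.2 then MvPolynomial.X p.1 else 0) F

/-- The polynomial function `z ↦ F(z)` belongs to the conjugation invariant Segal-Bargmann
space. -/
def IsInvariantPoly {n : ℕ} (F : MvPolynomial (Fin n × Fin n) ℂ) : Prop :=
  (fun z => MvPolynomial.eval z F) ∈ invariantSB n

end

/-!
The Segal-Bargmann inner product of two polynomials is their Fischer inner product
`∑_μ μ! conj(F_μ) G_μ` (`sbInner_eval`). For it, multiplication by `F` is adjoint to `F*(∂)`,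
where `F*` has the conjugate coefficients (`fischer_mul_left`). Conjugation invariant polynomials
are stable under `F ↦ F*` and `(F, G) ↦ F(∂) G`, and the alternating polynomials in the diagonal
entries are exactly the products `Δ · B|_D` with `B` invariant (`exists_invariant_of_alternating`):
`Δ` divides an alternating polynomial, and the elementary symmetric polynomials are restrictions of
coefficients of the characteristic polynomial. Both conditions of the theorem are equivalent to the
isometry of the canonical map on invariant polynomials (`IsPsiIsometric`).

If the map is isometric on polynomials, then for invariant `F`, `G`, `B` the two products
`c² ⟨Δ B|_D, Δ (F(∂) G)|_D⟩` and `c² ⟨Δ B|_D, F|_D(∂) (Δ G|_D)⟩` both equal `⟨F* B, G⟩`. The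
difference of the two sides of the differential operator identity is therefore orthogonal to all
`Δ B|_D`; being alternating, it is itself of this form, so it vanishes
(`diffOp_identity_of_isometry`).

Conversely, put `K = F*(∂) G`. The identity gives `⟨Δ F|_D, Δ G|_D⟩ = ⟨Δ, Δ K|_D⟩`. As `Δ` is
homogeneous this is `‖Δ‖² K(0)`, where `K(0) = ⟨F, G⟩` and `c² ‖Δ‖² = 1`
(`isometry_of_diffOp_identity`). To pass from polynomials to the whole space, an entire function is
expanded in homogeneous polynomials (`exists_homogeneous_expansion`). Parseval's identity, from
averaging over the rotations `z ↦ w z` with `|w| = 1`, computes its norm, finite or not, from those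
of the components (`gaussNormSq_eq_tsum`), and homogeneous polynomials with bounded norms sum to an
entire function by the reproducing kernel bound (`exists_entire_hasSum`). As the canonical map sends
homogeneous components to homogeneous components, it preserves norms, hence inner products by
polarisation, and it is surjective because it is so in each degree
(`IsPsiIsometric.exists_psi_eq`).
-/

noncomputable section

/-! ### Constant coefficient differential operators -/

open MvPolynomial in
theorem diffOp_eq_sum_of_subset {ι : Type} [Fintype ι] (F : MvPolynomial ι ℂ)
    {s : Finset (ι →₀ ℕ)} (hs : F.support ⊆ s) :
    diffOp F = ∑ μ ∈ s, F.coeff μ • iteratedPderiv μ := by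
  refine Finset.sum_subset hs fun μ _ hμ => ?_
  rw [notMem_support_iff.mp hμ, zero_smul]

theorem diffOp_add {ι : Type} [Fintype ι] (F G : MvPolynomial ι ℂ) :
    diffOp (F + G) = diffOp F + diffOp G := by
  classical
  rw [diffOp_eq_sum_of_subset (F + G) MvPolynomial.support_add,
    diffOp_eq_sum_of_subset F Finset.subset_union_left,
    diffOp_eq_sum_of_subset G Finset.subset_union_right, ← Finset.sum_add_distrib]
  exact Finset.sum_congr rfl fun μ _ => by rw [MvPolynomial.coeff_add, add_smul]

theorem diffOp_monomial {ι : Type} [Fintype ι] (μ : ι →₀ ℕ) (a : ℂ) :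
    diffOp (MvPolynomial.monomial μ a) = a • iteratedPderiv μ := by
  classical
  rw [diffOp_eq_sum_of_subset _ MvPolynomial.support_monomial_subset, Finset.sum_singleton,
    MvPolynomial.coeff_monomial, if_pos rfl]

theorem iteratedPderiv_add {ι : Type} [Fintype ι] (μ ν : ι →₀ ℕ) :
    iteratedPderiv (μ + ν) = iteratedPderiv μ * iteratedPderiv ν := by
  rw [iteratedPderiv, iteratedPderiv, iteratedPderiv, ← Finset.noncommProd_mul_distrib]
  · exact Finset.noncommProd_congr rfl (fun i _ => by simp [pow_add]) _
  · exact fun i _ j _ _ => (pderiv_commute i j).pow_pow _ _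

theorem iteratedPderiv_zero {ι : Type} [Fintype ι] : iteratedPderiv (0 : ι →₀ ℕ) = 1 := by
  rw [iteratedPderiv, Finset.noncommProd_eq_pow_card _ _ _ 1 (fun i _ => by simp), one_pow]

theorem iteratedPderiv_single {ι : Type} [Fintype ι] (i : ι) :
    iteratedPderiv (Finsupp.single i 1) =
      ((MvPolynomial.pderiv i).toLinearMap : Module.End ℂ (MvPolynomial ι ℂ)) := by
  classical
  have h : ∀ j ∈ Finset.univ.erase i,
      ((MvPolynomial.pderiv j).toLinearMap : Module.End ℂ (MvPolynomial ι ℂ)) ^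
        (Finsupp.single i 1 : ι →₀ ℕ) j = 1 := fun j hj => by
    rw [Finsupp.single_eq_of_ne (Finset.ne_of_mem_erase hj), pow_zero]
  refine (Finset.noncommProd_erase_mul Finset.univ (Finset.mem_univ i) _
    (pairwise_commute_pderiv_pow _)).symm.trans ?_
  refine (congrArg (· * _) (Finset.noncommProd_eq_pow_card _ _ _ 1 h)).trans ?_
  rw [one_pow, one_mul, Finsupp.single_eq_same, pow_one]

theorem diffOp_C {ι : Type} [Fintype ι] (a : ℂ) :
    diffOp (MvPolynomial.C a : MvPolynomial ι ℂ) = a • 1 := by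
  rw [MvPolynomial.C_apply, diffOp_monomial, iteratedPderiv_zero]

theorem diffOp_X {ι : Type} [Fintype ι] (i : ι) :
    diffOp (MvPolynomial.X i : MvPolynomial ι ℂ) = (MvPolynomial.pderiv i).toLinearMap := by
  rw [MvPolynomial.X, diffOp_monomial, iteratedPderiv_single, one_smul]

theorem diffOp_mul {ι : Type} [Fintype ι] (F G : MvPolynomial ι ℂ) :
    diffOp (F * G) = diffOp F * diffOp G := by
  induction F using MvPolynomial.induction_on' with
  | add p q hp hq => rw [add_mul, diffOp_add, hp, hq, diffOp_add, add_mul]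
  | monomial μ a =>
    induction G using MvPolynomial.induction_on' with
    | add p q hp hq => rw [mul_add, diffOp_add, hp, hq, diffOp_add, mul_add]
    | monomial ν b =>
      rw [MvPolynomial.monomial_mul, diffOp_monomial, diffOp_monomial, diffOp_monomial,
        iteratedPderiv_add, smul_mul_smul_comm]

theorem diffOp_sum {ι κ : Type} [Fintype ι] (s : Finset κ) (F : κ → MvPolynomial ι ℂ) :
    diffOp (∑ k ∈ s, F k) = ∑ k ∈ s, diffOp (F k) :=
  map_sum (AddMonoidHom.mk' diffOp diffOp_add) F s

/-- Chain rule for constant coefficient operators: if the substitution `T` intertwines the partial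
derivatives with the operators attached to the transposed substitution `T'`, then it intertwines
`F(∂)` with `(T' F)(∂)`. -/
theorem diffOp_algHom {ι : Type} [Fintype ι] (T T' : MvPolynomial ι ℂ →ₐ[ℂ] MvPolynomial ι ℂ)
    (h : ∀ i G, MvPolynomial.pderiv i (T G) = T (diffOp (T' (MvPolynomial.X i)) G))
    (F G : MvPolynomial ι ℂ) : diffOp F (T G) = T (diffOp (T' F) G) := by
  induction F using MvPolynomial.induction_on generalizing G with
  | C a =>
    have : T' (MvPolynomial.C a) = MvPolynomial.C a := T'.commutes a
    rw [this, diffOp_C, LinearMap.smul_apply, LinearMap.smul_apply, map_smul]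
    rfl
  | add p q hp hq =>
    rw [diffOp_add, map_add, diffOp_add, LinearMap.add_apply, LinearMap.add_apply, map_add, hp, hq]
  | mul_X p i hp =>
    rw [diffOp_mul, map_mul, diffOp_mul, Module.End.mul_apply, Module.End.mul_apply, diffOp_X,
      ← hp, ← h]
    rfl

/-- The linear substitution `X_p ↦ ∑_q M_{pq} X_q`. -/
def linSubst {ι : Type} [Fintype ι] (M : Matrix ι ι ℂ) :
    MvPolynomial ι ℂ →ₐ[ℂ] MvPolynomial ι ℂ :=
  MvPolynomial.aeval fun p => ∑ q, M p q • MvPolynomial.X q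

theorem eval_linSubst {ι : Type} [Fintype ι] (M : Matrix ι ι ℂ) (F : MvPolynomial ι ℂ)
    (z : ι → ℂ) : MvPolynomial.eval z (linSubst M F) = MvPolynomial.eval (M.mulVec z) F := by
  rw [linSubst, MvPolynomial.aeval_def, MvPolynomial.algebraMap_eq,
    MvPolynomial.eval_eval₂, MvPolynomial.eval, MvPolynomial.coe_eval₂Hom]
  congr 1
  · ext a; simp
  · funext p
    simp [Matrix.mulVec, dotProduct]

/-- The chain rule for a linear substitution, with the transposed substitution in the symbol. -/
theorem diffOp_linSubst {ι : Type} [Fintype ι] (M : Matrix ι ι ℂ) (F G : MvPolynomial ι ℂ) :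
    diffOp F (linSubst M G) = linSubst M (diffOp (linSubst M.transpose F) G) := by
  classical
  refine diffOp_algHom _ _ (fun i G => ?_) F G
  have key : ∀ G, diffOp (linSubst M.transpose (MvPolynomial.X i)) G =
      ∑ q, M q i • MvPolynomial.pderiv q G := by
    intro G
    rw [linSubst, MvPolynomial.aeval_X, diffOp_sum, LinearMap.sum_apply]
    refine Finset.sum_congr rfl fun q _ => ?_
    rw [MvPolynomial.smul_eq_C_mul, diffOp_mul, diffOp_C, diffOp_X, smul_mul_assoc, one_mul]
    rfl
  rw [key]
  induction G using MvPolynomial.induction_on with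
  | C a => simp [linSubst]
  | add p q hp hq => simp only [map_add, hp, hq, smul_add, Finset.sum_add_distrib]
  | mul_X p j hp =>
    have hX : linSubst M (MvPolynomial.X j) = ∑ q, M j q • MvPolynomial.X q := by
      rw [linSubst, MvPolynomial.aeval_X]
    have hd : MvPolynomial.pderiv i (∑ q, M j q • (MvPolynomial.X q : MvPolynomial ι ℂ)) =
        MvPolynomial.C (M j i) := by
      simp [MvPolynomial.pderiv_X, Pi.single_apply, MvPolynomial.smul_eq_C_mul]
    rw [map_mul, Derivation.leibniz, hp, hX, hd]
    simp only [Derivation.leibniz, MvPolynomial.pderiv_X, Pi.single_apply, smul_add, map_add,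
      Finset.sum_add_distrib, smul_eq_mul, map_smul, map_mul, hX, map_sum]
    congr 1
    · simp [MvPolynomial.smul_eq_C_mul, mul_comm]
    · simp [Finset.mul_sum]

theorem diffOp_rename {ι : Type} [Fintype ι] (σ : Equiv.Perm ι) (F G : MvPolynomial ι ℂ) :
    diffOp F (MvPolynomial.rename σ G) =
      MvPolynomial.rename σ (diffOp (MvPolynomial.rename (σ⁻¹ : Equiv.Perm ι) F) G) := by
  refine diffOp_algHom _ _ (fun i G => ?_) F G
  rw [MvPolynomial.rename_X, diffOp_X]
  conv_lhs => rw [show i = σ (σ⁻¹ i) by simp]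
  exact MvPolynomial.pderiv_rename σ.injective _ _

/-! ### The Fischer inner product -/

/-- The Fischer inner product `∑_μ μ! conj(F_μ) G_μ` of polynomials. -/
def fischer {ι : Type} [Fintype ι] (F G : MvPolynomial ι ℂ) : ℂ :=
  ∑ μ ∈ F.support, starRingEnd ℂ (F.coeff μ) * G.coeff μ * ((∏ i, (μ i)! : ℕ) : ℂ)

theorem fischer_eq_sum_of_subset {ι : Type} [Fintype ι] (F G : MvPolynomial ι ℂ)
    {s : Finset (ι →₀ ℕ)} (hs : F.support ⊆ s) :
    fischer F G =
      ∑ μ ∈ s, starRingEnd ℂ (F.coeff μ) * G.coeff μ * ((∏ i, (μ i)! : ℕ) : ℂ) := by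
  refine Finset.sum_subset hs fun μ _ hμ => ?_
  rw [MvPolynomial.notMem_support_iff.mp hμ]
  simp

theorem fischer_add_right {ι : Type} [Fintype ι] (F G H : MvPolynomial ι ℂ) :
    fischer F (G + H) = fischer F G + fischer F H := by
  simp only [fischer, MvPolynomial.coeff_add, mul_add, add_mul, Finset.sum_add_distrib]

theorem fischer_C_mul_right {ι : Type} [Fintype ι] (a : ℂ) (F G : MvPolynomial ι ℂ) :
    fischer F (MvPolynomial.C a * G) = a * fischer F G := by
  simp only [fischer, MvPolynomial.coeff_C_mul, Finset.mul_sum]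
  exact Finset.sum_congr rfl fun μ _ => by ring

theorem fischer_conj_symm {ι : Type} [Fintype ι] (F G : MvPolynomial ι ℂ) :
    starRingEnd ℂ (fischer F G) = fischer G F := by
  classical
  rw [fischer_eq_sum_of_subset F G Finset.subset_union_left,
    fischer_eq_sum_of_subset G F Finset.subset_union_right, map_sum]
  refine Finset.sum_congr rfl fun μ _ => ?_
  simp only [map_mul, Complex.conj_conj, map_natCast]
  ring

theorem fischer_add_left {ι : Type} [Fintype ι] (F G H : MvPolynomial ι ℂ) :
    fischer (F + G) H = fischer F H + fischer G H := by
  rw [← fischer_conj_symm, fischer_add_right, map_add, fischer_conj_symm, fischer_conj_symm]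

theorem fischer_C_mul_left {ι : Type} [Fintype ι] (a : ℂ) (F G : MvPolynomial ι ℂ) :
    fischer (MvPolynomial.C a * F) G = starRingEnd ℂ a * fischer F G := by
  rw [← fischer_conj_symm, fischer_C_mul_right, map_mul, fischer_conj_symm]

theorem fischer_sub_right {ι : Type} [Fintype ι] (F G H : MvPolynomial ι ℂ) :
    fischer F (G - H) = fischer F G - fischer F H := by
  simp only [fischer, MvPolynomial.coeff_sub, mul_sub, sub_mul, Finset.sum_sub_distrib]

theorem fischer_monomial_left {ι : Type} [Fintype ι] (μ : ι →₀ ℕ) (a : ℂ)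
    (G : MvPolynomial ι ℂ) :
    fischer (MvPolynomial.monomial μ a) G =
      starRingEnd ℂ a * G.coeff μ * ((∏ i, (μ i)! : ℕ) : ℂ) := by
  classical
  rw [fischer_eq_sum_of_subset _ _ MvPolynomial.support_monomial_subset, Finset.sum_singleton,
    MvPolynomial.coeff_monomial, if_pos rfl]

/-- The square of the Fischer norm of a polynomial. -/
def fischerNormSq {ι : Type} [Fintype ι] (F : MvPolynomial ι ℂ) : ℝ :=
  ∑ μ ∈ F.support, ‖F.coeff μ‖ ^ 2 * ((∏ i, (μ i)! : ℕ) : ℝ)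

theorem fischer_self {ι : Type} [Fintype ι] (F : MvPolynomial ι ℂ) :
    fischer F F = (fischerNormSq F : ℂ) := by
  rw [fischer, fischerNormSq, Complex.ofReal_sum]
  refine Finset.sum_congr rfl fun μ _ => ?_
  rw [mul_comm (starRingEnd ℂ _), Complex.mul_conj, Complex.normSq_eq_norm_sq]
  push_cast
  ring

theorem fischerNormSq_nonneg {ι : Type} [Fintype ι] (F : MvPolynomial ι ℂ) :
    0 ≤ fischerNormSq F :=
  Finset.sum_nonneg fun _ _ => by positivity

theorem eq_zero_of_fischer_self {ι : Type} [Fintype ι] {F : MvPolynomial ι ℂ}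
    (h : fischer F F = 0) : F = 0 := by
  rw [fischer_self, Complex.ofReal_eq_zero, fischerNormSq,
    Finset.sum_eq_zero_iff_of_nonneg fun _ _ => by positivity] at h
  by_contra hF
  obtain ⟨μ, hμ⟩ := Finset.nonempty_of_ne_empty (mt MvPolynomial.support_eq_empty.mp hF)
  have h1 := h μ hμ
  have h2 : 0 < ‖F.coeff μ‖ ^ 2 * ((∏ i, (μ i)! : ℕ) : ℝ) := by
    have := norm_pos_iff.mpr (MvPolynomial.mem_support_iff.mp hμ)
    have h3 : 0 < ∏ i, (μ i)! := Finset.prod_pos fun i _ => Nat.factorial_pos _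
    positivity
  exact h2.ne' h1

/-- Multiplication by a variable is adjoint to the corresponding partial derivative. -/
theorem fischer_X_mul {ι : Type} [Fintype ι] (i : ι) (H G : MvPolynomial ι ℂ) :
    fischer (MvPolynomial.X i * H) G = fischer H (MvPolynomial.pderiv i G) := by
  classical
  induction H using MvPolynomial.induction_on' with
  | add p q hp hq => rw [mul_add, fischer_add_left, hp, hq, fischer_add_left]
  | monomial μ a =>
    rw [MvPolynomial.X, MvPolynomial.monomial_mul, one_mul, fischer_monomial_left,
      fischer_monomial_left, MvPolynomial.coeff_pderiv, add_comm (Finsupp.single i 1) μ]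
    have h : (∏ j, ((μ + Finsupp.single i 1 : ι →₀ ℕ) j)!) = (μ i + 1) * ∏ j, (μ j)! := by
      rw [← Finset.mul_prod_erase _ _ (Finset.mem_univ i),
        ← Finset.mul_prod_erase (f := fun j => (μ j)!) _ (Finset.mem_univ i)]
      rw [Finset.prod_congr rfl (g := fun j => (μ j)!)]
      · simp [Nat.factorial_succ, mul_assoc]
      · intro j hj
        simp [Finsupp.single_eq_of_ne (Finset.ne_of_mem_erase hj)]
    rw [h]
    push_cast
    ring

/-- The polynomial with complex conjugated coefficients. -/
abbrev conjPoly {ι : Type} : MvPolynomial ι ℂ →+* MvPolynomial ι ℂ :=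
  MvPolynomial.map (starRingEnd ℂ)

theorem conjPoly_conjPoly {ι : Type} (F : MvPolynomial ι ℂ) : conjPoly (conjPoly F) = F := by
  rw [MvPolynomial.map_map, show (starRingEnd ℂ).comp (starRingEnd ℂ) =
    RingHom.id ℂ from RingHom.ext Complex.conj_conj, MvPolynomial.map_id]

/-- Multiplication by `F` is adjoint to the differential operator of the conjugate of `F`. -/
theorem fischer_mul_left {ι : Type} [Fintype ι] (F H G : MvPolynomial ι ℂ) :
    fischer (F * H) G = fischer H (diffOp (conjPoly F) G) := by
  induction F using MvPolynomial.induction_on generalizing H with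
  | C a =>
    rw [fischer_C_mul_left, conjPoly, MvPolynomial.map_C, diffOp_C, LinearMap.smul_apply,
      MvPolynomial.smul_eq_C_mul, fischer_C_mul_right]
    rfl
  | add p q hp hq =>
    rw [add_mul, fischer_add_left, hp, hq, map_add, diffOp_add, LinearMap.add_apply,
      fischer_add_right]
  | mul_X p i hp =>
    rw [mul_assoc, hp, fischer_X_mul, map_mul, mul_comm, diffOp_mul,
      MvPolynomial.map_X, diffOp_X]
    rfl

/-- The value at the origin of `F*(∂) G` is the Fischer inner product, by adjointness against the
constant `1`. -/
theorem constantCoeff_diffOp {ι : Type} [Fintype ι] (F G : MvPolynomial ι ℂ) :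
    MvPolynomial.constantCoeff (diffOp (conjPoly F) G) = fischer F G := by
  rw [← mul_one F, fischer_mul_left, mul_one, ← MvPolynomial.C_1, MvPolynomial.C_apply,
    fischer_monomial_left]
  simp [MvPolynomial.constantCoeff_eq]

theorem fischer_eq_zero_of_isHomogeneous {ι : Type} [Fintype ι] {F G : MvPolynomial ι ℂ}
    {d e : ℕ} (hF : F.IsHomogeneous d) (hG : G.IsHomogeneous e) (h : d ≠ e) :
    fischer F G = 0 := by
  refine Finset.sum_eq_zero fun μ hμ => ?_
  have hd : μ.degree = d := by
    rw [Finsupp.degree_eq_weight_one]; exact hF (MvPolynomial.mem_support_iff.mp hμ)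
  rw [hG.coeff_eq_zero (d := μ) (by rw [hd]; exact h)]
  simp

/-- Components of `H` of positive degree move a homogeneous `F` to a higher degree, hence do not
contribute to `⟨F, F H⟩`. -/
theorem fischer_mul_right_of_isHomogeneous {ι : Type} [Fintype ι] {F : MvPolynomial ι ℂ} {d : ℕ}
    (hF : F.IsHomogeneous d) (H : MvPolynomial ι ℂ) :
    fischer F (F * H) = fischer F F * MvPolynomial.constantCoeff H := by
  classical
  induction H using MvPolynomial.induction_on' with
  | add p q hp hq => rw [mul_add, fischer_add_right, hp, hq, map_add, mul_add]
  | monomial μ a =>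
    by_cases hμ : μ = 0
    · subst hμ
      rw [← MvPolynomial.C_apply, mul_comm F, fischer_C_mul_right, MvPolynomial.constantCoeff_C,
        mul_comm]
    · rw [fischer_eq_zero_of_isHomogeneous hF
        (hF.mul (MvPolynomial.isHomogeneous_monomial a (rfl : μ.degree = μ.degree))),
        MvPolynomial.constantCoeff_monomial, if_neg hμ, mul_zero]
      have : μ.degree ≠ 0 := by rwa [Ne, Finsupp.degree_eq_zero_iff]
      omega

/-! ### Alternating polynomials -/

theorem vandermondeProd_eq_det {R : Type*} [CommRing R] {n : ℕ} (v : Fin n → R) :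
    vandermondeProd v = (Matrix.vandermonde v).det :=
  (Matrix.det_vandermonde v).symm

theorem vandermondeProd_comp_perm {R : Type*} [CommRing R] {n : ℕ} (v : Fin n → R)
    (σ : Equiv.Perm (Fin n)) :
    vandermondeProd (v ∘ σ) = ((Equiv.Perm.sign σ : ℤ) : R) * vandermondeProd v := by
  rw [vandermondeProd_eq_det, vandermondeProd_eq_det, ← Matrix.det_permute]
  rfl

theorem map_vandermondeProd {R S : Type*} [CommRing R] [CommRing S] {n : ℕ} (f : R →+* S)
    (v : Fin n → R) : f (vandermondeProd v) = vandermondeProd (f ∘ v) := by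
  simp [vandermondeProd, map_prod]

/-- The Vandermonde product as a polynomial. -/
abbrev vandermondePoly (n : ℕ) : MvPolynomial (Fin n) ℂ :=
  vandermondeProd fun i => (MvPolynomial.X i : MvPolynomial (Fin n) ℂ)

theorem eval_vandermondePoly {n : ℕ} (x : Fin n → ℂ) :
    MvPolynomial.eval x (vandermondePoly n) = vandermondeProd x := by
  rw [vandermondePoly, map_vandermondeProd]
  congr 1
  funext i
  simp

theorem rename_vandermondePoly {n : ℕ} (σ : Equiv.Perm (Fin n)) :
    MvPolynomial.rename σ (vandermondePoly n) =
      ((Equiv.Perm.sign σ : ℤ) : MvPolynomial (Fin n) ℂ) * vandermondePoly n := by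
  rw [← vandermondeProd_comp_perm]
  refine (map_vandermondeProd
    (MvPolynomial.rename (R := ℂ) σ : MvPolynomial (Fin n) ℂ →+* MvPolynomial (Fin n) ℂ) _).trans ?_
  congr 1
  funext i
  exact MvPolynomial.rename_X _ _

theorem vandermondePoly_ne_zero (n : ℕ) : vandermondePoly n ≠ 0 := by
  refine Finset.prod_ne_zero_iff.mpr fun i _ => Finset.prod_ne_zero_iff.mpr fun j hj => ?_
  exact sub_ne_zero.mpr fun h => (Finset.mem_Ioi.mp hj).ne' (MvPolynomial.X_injective h)

theorem isHomogeneous_vandermondePoly (n : ℕ) :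
    (vandermondePoly n).IsHomogeneous (∑ i : Fin n, (Finset.Ioi i).card) := by
  refine MvPolynomial.IsHomogeneous.prod _ _ _ fun i _ => ?_
  rw [Finset.card_eq_sum_ones]
  refine MvPolynomial.IsHomogeneous.prod _ _ _ fun j _ => ?_
  exact (MvPolynomial.isHomogeneous_X _ _).sub (MvPolynomial.isHomogeneous_X _ _)

/-- The substitution `X_a ↦ X_b`. -/
def identifyVar {ι : Type} [DecidableEq ι] (a b : ι) :
    MvPolynomial ι ℂ →ₐ[ℂ] MvPolynomial ι ℂ :=
  MvPolynomial.aeval fun i => if i = a then MvPolynomial.X b else MvPolynomial.X i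

/-- The substitution `X_a ↦ X_b` does not change a polynomial modulo `X_a - X_b`. -/
theorem X_sub_X_dvd_sub_identifyVar {ι : Type} [DecidableEq ι] (a b : ι)
    (P : MvPolynomial ι ℂ) :
    (MvPolynomial.X a - MvPolynomial.X b : MvPolynomial ι ℂ) ∣ P - identifyVar a b P := by
  induction P using MvPolynomial.induction_on with
  | C c => simp [identifyVar]
  | add p q hp hq =>
    rw [map_add, add_sub_add_comm]
    exact dvd_add hp hq
  | mul_X p i hp =>
    rw [map_mul, show p * MvPolynomial.X i - identifyVar a b p * identifyVar a b (MvPolynomial.X i)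
      = (p - identifyVar a b p) * MvPolynomial.X i + identifyVar a b p *
        (MvPolynomial.X i - identifyVar a b (MvPolynomial.X i)) by ring]
    refine dvd_add (hp.mul_right _) (Dvd.dvd.mul_left ?_ _)
    rw [identifyVar, MvPolynomial.aeval_X]
    split_ifs with h
    · rw [h]
    · simp

theorem X_sub_X_dvd_iff {ι : Type} [DecidableEq ι] (a b : ι) (P : MvPolynomial ι ℂ) :
    (MvPolynomial.X a - MvPolynomial.X b : MvPolynomial ι ℂ) ∣ P ↔ identifyVar a b P = 0 := by
  constructor
  · rintro ⟨Q, rfl⟩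
    have h : identifyVar a b (MvPolynomial.X a - MvPolynomial.X b) = 0 := by
      simp [identifyVar]
    rw [map_mul, h, zero_mul]
  · intro h
    simpa [h] using X_sub_X_dvd_sub_identifyVar a b P

theorem prime_X_sub_X {ι : Type} {a b : ι} (hab : a ≠ b) :
    Prime (MvPolynomial.X a - MvPolynomial.X b : MvPolynomial ι ℂ) := by
  classical
  refine ⟨sub_ne_zero.mpr fun h => hab (MvPolynomial.X_injective h), fun h => ?_, fun P Q h => ?_⟩
  · have := (X_sub_X_dvd_iff a b 1).mp h.dvd
    simp at this
  · rw [X_sub_X_dvd_iff, map_mul, mul_eq_zero] at h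
    exact h.imp (X_sub_X_dvd_iff a b P).mpr (X_sub_X_dvd_iff a b Q).mpr

theorem identifyVar_rename_swap {ι : Type} [DecidableEq ι] (a b : ι) (P : MvPolynomial ι ℂ) :
    identifyVar a b (MvPolynomial.rename (Equiv.swap a b) P) = identifyVar a b P := by
  rw [identifyVar, MvPolynomial.aeval_rename]
  congr 2
  funext i
  simp only [Function.comp_apply, Equiv.swap_apply_def]
  split_ifs <;> simp_all

/-- An alternating polynomial is the Vandermonde product times a symmetric polynomial. -/
theorem exists_symmetric_of_alternating {n : ℕ} (P : MvPolynomial (Fin n) ℂ)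
    (hP : ∀ σ : Equiv.Perm (Fin n), MvPolynomial.rename σ P =
      ((Equiv.Perm.sign σ : ℤ) : MvPolynomial (Fin n) ℂ) * P) :
    ∃ Q : MvPolynomial (Fin n) ℂ, Q.IsSymmetric ∧ P = vandermondePoly n * Q := by
  have hdvd : vandermondePoly n ∣ P := by
    rw [vandermondePoly, vandermondeProd, Finset.prod_sigma']
    -- distinct factors `X_j - X_i` are non-associated primes, and each divides `P`
    refine Finset.prod_dvd_of_isRelPrime ?_ ?_
    · rintro ⟨i, j⟩ hij ⟨k, l⟩ hkl hne
      simp only [Finset.coe_sigma, Set.mem_sigma_iff, Finset.mem_coe, Finset.mem_univ, true_and,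
        Finset.mem_Ioi] at hij hkl
      refine ((prime_X_sub_X hij.ne').irreducible.isRelPrime_iff_not_dvd).mpr ?_
      rw [X_sub_X_dvd_iff, map_sub, identifyVar, MvPolynomial.aeval_X, MvPolynomial.aeval_X,
        sub_eq_zero]
      intro h
      apply hne
      dsimp only at h hij hkl
      split_ifs at h with h1 h2 h2 <;> replace h := MvPolynomial.X_injective h
      · omega
      · rw [h, h1]
      · omega
      · omega
    · rintro ⟨i, j⟩ hij
      simp only [Finset.mem_sigma, Finset.mem_univ, true_and, Finset.mem_Ioi] at hij
      rw [X_sub_X_dvd_iff, ← self_eq_neg, ← map_neg]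
      -- the substitution `X_j ↦ X_i` does not see the swap of `i` and `j`, which changes the sign
      conv_lhs => rw [← identifyVar_rename_swap, hP, Equiv.Perm.sign_swap hij.ne']
      simp
  obtain ⟨Q, rfl⟩ := hdvd
  refine ⟨Q, fun σ => ?_, rfl⟩
  have h := hP σ
  rw [map_mul, rename_vandermondePoly, mul_assoc] at h
  have hs : ((Equiv.Perm.sign σ : ℤ) : MvPolynomial (Fin n) ℂ) ≠ 0 := by
    rcases Int.units_eq_one_or (Equiv.Perm.sign σ) with h | h <;> simp [h]
  exact mul_left_cancel₀ (vandermondePoly_ne_zero n) (mul_left_cancel₀ hs h)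

/-! ### Restriction of invariant polynomials -/

theorem eval_restrictDiag {n : ℕ} (F : MvPolynomial (Fin n × Fin n) ℂ) (x : Fin n → ℂ) :
    MvPolynomial.eval x (restrictDiag F) =
      MvPolynomial.eval (entries (Matrix.diagonal x)) F := by
  rw [restrictDiag, MvPolynomial.aeval_def, MvPolynomial.algebraMap_eq,
    MvPolynomial.eval_eval₂, MvPolynomial.eval, MvPolynomial.coe_eval₂Hom]
  congr 1
  · ext a; simp
  · funext p
    by_cases h : p.1 = p.2 <;> simp [entries, h]

theorem constantCoeff_restrictDiag {n : ℕ} (F : MvPolynomial (Fin n × Fin n) ℂ) :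
    MvPolynomial.constantCoeff (restrictDiag F) = MvPolynomial.constantCoeff F := by
  rw [← MvPolynomial.eval_zero, ← MvPolynomial.eval_zero, eval_restrictDiag]
  congr 2
  funext p
  simp [entries]

theorem restrictDiag_conjPoly {n : ℕ} (F : MvPolynomial (Fin n × Fin n) ℂ) :
    restrictDiag (conjPoly F) = conjPoly (restrictDiag F) := by
  rw [restrictDiag, restrictDiag, MvPolynomial.map_aeval, MvPolynomial.aeval_def,
    MvPolynomial.algebraMap_eq, MvPolynomial.eval₂_map, MvPolynomial.coe_eval₂Hom]
  congr 1
  · ext a; simp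
  · funext p
    split_ifs <;> simp

theorem isHomogeneous_restrictDiag {n : ℕ} {F : MvPolynomial (Fin n × Fin n) ℂ} {k : ℕ}
    (hF : F.IsHomogeneous k) : (restrictDiag F).IsHomogeneous k := by
  have h := hF.aeval (fun p : Fin n × Fin n =>
    if p.1 = p.2 then (MvPolynomial.X p.1 : MvPolynomial (Fin n) ℂ) else 0) (n := 1) fun p => by
      split_ifs
      · exact MvPolynomial.isHomogeneous_X _ _
      · exact MvPolynomial.isHomogeneous_zero _ _ _
  rwa [one_mul] at h

/-- The matrix, on the coordinates `(i, j)`, of the conjugation `A ↦ u⁻¹ A u`. -/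
def conjMatrix {n : ℕ} (u : Matrix.unitaryGroup (Fin n) ℂ) :
    Matrix (Fin n × Fin n) (Fin n × Fin n) ℂ :=
  fun p q => (↑(u⁻¹) : Matrix (Fin n) (Fin n) ℂ) p.1 q.1 * (u : Matrix (Fin n) (Fin n) ℂ) q.2 p.2

theorem conjMatrix_mulVec_entries {n : ℕ} (u : Matrix.unitaryGroup (Fin n) ℂ)
    (A : Matrix (Fin n) (Fin n) ℂ) :
    (conjMatrix u).mulVec (entries A) =
      entries ((↑(u⁻¹) : Matrix (Fin n) (Fin n) ℂ) * A * (u : Matrix (Fin n) (Fin n) ℂ)) := by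
  funext p
  simp only [Matrix.mulVec, dotProduct, conjMatrix, entries, Fintype.sum_prod_type,
    Matrix.mul_apply, Finset.sum_mul]
  rw [Finset.sum_comm]
  exact Finset.sum_congr rfl fun _ _ => Finset.sum_congr rfl fun _ _ => by ring

theorem entries_surjective {n : ℕ} (z : Fin n × Fin n → ℂ) :
    ∃ A : Matrix (Fin n) (Fin n) ℂ, entries A = z :=
  ⟨fun i j => z (i, j), rfl⟩

/-- Invariance of a function of the matrix entries under conjugation by unitary matrices. -/
def IsConjInvariant {n : ℕ} (F : (Fin n × Fin n → ℂ) → ℂ) : Prop :=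
  ∀ (u : Matrix.unitaryGroup (Fin n) ℂ) (z : Fin n × Fin n → ℂ), F z = F ((conjMatrix u).mulVec z)

theorem isConjInvariant_iff {n : ℕ} (F : (Fin n × Fin n → ℂ) → ℂ) :
    IsConjInvariant F ↔
      ∀ (u : Matrix.unitaryGroup (Fin n) ℂ) (A : Matrix (Fin n) (Fin n) ℂ),
      F (entries A) =
        F (entries ((↑(u⁻¹) : Matrix (Fin n) (Fin n) ℂ) * A *
          (u : Matrix (Fin n) (Fin n) ℂ))) := by
  refine forall_congr' fun u => ⟨fun h A => ?_, fun h z => ?_⟩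
  · rw [h, conjMatrix_mulVec_entries]
  · obtain ⟨A, rfl⟩ := entries_surjective z
    rw [h, conjMatrix_mulVec_entries]

/-- Invariance of a polynomial, as an identity of polynomials. -/
theorem isConjInvariant_eval_iff {n : ℕ} (F : MvPolynomial (Fin n × Fin n) ℂ) :
    (IsConjInvariant fun z => MvPolynomial.eval z F) ↔
      ∀ u : Matrix.unitaryGroup (Fin n) ℂ, linSubst (conjMatrix u) F = F := by
  refine forall_congr' fun u => ⟨fun h => MvPolynomial.funext fun z => ?_, fun h z => ?_⟩
  · rw [eval_linSubst]
    exact (h z).symm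
  · change MvPolynomial.eval z F = MvPolynomial.eval _ F
    rw [← eval_linSubst, h]

/-- The transpose of a unitary matrix. -/
def unitaryTranspose {n : ℕ} (u : Matrix.unitaryGroup (Fin n) ℂ) :
    Matrix.unitaryGroup (Fin n) ℂ :=
  ⟨(u : Matrix (Fin n) (Fin n) ℂ).transpose, by
    rw [Matrix.mem_unitaryGroup_iff]
    change (u : Matrix (Fin n) (Fin n) ℂ).transpose *
      (star (u : Matrix (Fin n) (Fin n) ℂ)).transpose = 1
    rw [← Matrix.transpose_mul, Matrix.mem_unitaryGroup_iff'.mp u.2, Matrix.transpose_one]⟩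

theorem conjMatrix_transpose {n : ℕ} (u : Matrix.unitaryGroup (Fin n) ℂ) :
    (conjMatrix u).transpose = conjMatrix (unitaryTranspose u) := by
  ext p q
  simp [conjMatrix, unitaryTranspose, Matrix.star_apply, Matrix.transpose_apply]

/-- The entrywise conjugate of a unitary matrix. -/
def unitaryConj {n : ℕ} (u : Matrix.unitaryGroup (Fin n) ℂ) : Matrix.unitaryGroup (Fin n) ℂ :=
  unitaryTranspose u⁻¹

/-- The operator `F(∂)` of an invariant polynomial preserves invariance: the transpose of a
conjugation by a unitary matrix is again one. -/
theorem isConjInvariant_diffOp {n : ℕ} {F G : MvPolynomial (Fin n × Fin n) ℂ}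
    (hF : IsConjInvariant fun z => MvPolynomial.eval z F)
    (hG : IsConjInvariant fun z => MvPolynomial.eval z G) :
    IsConjInvariant fun z => MvPolynomial.eval z (diffOp F G) := by
  rw [isConjInvariant_eval_iff] at hF hG ⊢
  intro u
  conv_rhs => rw [← hG u, diffOp_linSubst, conjMatrix_transpose, hF]

theorem eval_conjPoly {ι : Type} (F : MvPolynomial ι ℂ) (z : ι → ℂ) :
    MvPolynomial.eval z (conjPoly F) =
      starRingEnd ℂ (MvPolynomial.eval (fun p => starRingEnd ℂ (z p)) F) := by
  rw [MvPolynomial.eval_map, ← MvPolynomial.eval₂_id, MvPolynomial.eval₂_comp_left]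
  congr 1
  funext p
  simp

theorem isConjInvariant_conjPoly {n : ℕ} {F : MvPolynomial (Fin n × Fin n) ℂ}
    (hF : IsConjInvariant fun z => MvPolynomial.eval z F) :
    IsConjInvariant fun z => MvPolynomial.eval z (conjPoly F) := by
  intro u z
  simp only [eval_conjPoly]
  refine congrArg _ ((hF (unitaryConj u) _).trans ?_)
  change MvPolynomial.eval _ F = MvPolynomial.eval _ F
  congr 2
  funext p
  simp [Matrix.mulVec, dotProduct, conjMatrix, unitaryConj, unitaryTranspose, map_sum,
    Matrix.star_apply]

/-- The permutation matrix with `u⁻¹ diag(x) u = diag(x ∘ σ)`. -/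
def unitaryPerm {n : ℕ} (σ : Equiv.Perm (Fin n)) : Matrix.unitaryGroup (Fin n) ℂ :=
  ⟨Matrix.of fun i j => if i = σ j then 1 else 0, by
    rw [Matrix.mem_unitaryGroup_iff']
    ext i j
    simp [Matrix.mul_apply, Matrix.star_apply, Matrix.one_apply, apply_ite, eq_comm]⟩

/-- An invariant function is symmetric on the diagonal matrices, since permutation matrices are
unitary. -/
theorem IsConjInvariant.diagonal_comp {n : ℕ} {F : (Fin n × Fin n → ℂ) → ℂ}
    (hF : IsConjInvariant F) (σ : Equiv.Perm (Fin n)) (x : Fin n → ℂ) :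
    F (entries (Matrix.diagonal (x ∘ σ))) = F (entries (Matrix.diagonal x)) := by
  rw [hF (unitaryPerm σ) (entries (Matrix.diagonal x)), conjMatrix_mulVec_entries]
  congr 2
  ext i j
  by_cases h : i = j
  · subst h
    simp [unitaryPerm, Matrix.mul_apply, Matrix.star_apply, Matrix.diagonal_apply, apply_ite]
  · simp [unitaryPerm, Matrix.mul_apply, Matrix.star_apply, h, apply_ite]

theorem isSymmetric_restrictDiag {n : ℕ} {F : MvPolynomial (Fin n × Fin n) ℂ}
    (hF : IsConjInvariant fun z => MvPolynomial.eval z F) : (restrictDiag F).IsSymmetric := by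
  intro σ
  refine MvPolynomial.funext fun x => ?_
  rw [MvPolynomial.eval_rename, eval_restrictDiag, eval_restrictDiag]
  exact hF.diagonal_comp σ x

/-- The elementary symmetric polynomials of the eigenvalues, as polynomials in the matrix
entries. -/
def genericEsymm (n k : ℕ) : MvPolynomial (Fin n × Fin n) ℂ :=
  (-Matrix.mvPolynomialX (Fin n) (Fin n) ℂ).charpoly.coeff (n - k)

theorem restrictDiag_genericEsymm (n k : ℕ) (hk : k ≤ n) :
    restrictDiag (genericEsymm n k) = MvPolynomial.esymm (Fin n) ℂ k := by
  have h := MvPolynomial.prod_X_add_C_coeff ℂ (Fin n) (n - k) (by simp)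
  rw [Fintype.card_fin, Nat.sub_sub_self hk] at h
  rw [← h, genericEsymm]
  change (MvPolynomial.aeval (R := ℂ) (fun p : Fin n × Fin n =>
    if p.1 = p.2 then (MvPolynomial.X p.1 : MvPolynomial (Fin n) ℂ) else 0)).toRingHom _ = _
  rw [← Polynomial.coeff_map, ← Matrix.charpoly_map]
  have hM : (-Matrix.mvPolynomialX (Fin n) (Fin n) ℂ).map
      (MvPolynomial.aeval (R := ℂ) (fun p : Fin n × Fin n =>
        if p.1 = p.2 then (MvPolynomial.X p.1 : MvPolynomial (Fin n) ℂ) else 0)).toRingHom =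
      Matrix.diagonal fun i => -(MvPolynomial.X i : MvPolynomial (Fin n) ℂ) := by
    ext i j
    by_cases h : i = j <;> simp [h]
  rw [hM, Matrix.charpoly_diagonal]
  simp

theorem eval_genericEsymm (n k : ℕ) (A : Matrix (Fin n) (Fin n) ℂ) :
    MvPolynomial.eval (entries A) (genericEsymm n k) = (-A).charpoly.coeff (n - k) := by
  rw [genericEsymm, ← Polynomial.coeff_map, ← Matrix.charpoly_map]
  congr 2
  ext i j
  simp [entries]

theorem isConjInvariant_genericEsymm (n k : ℕ) :
    IsConjInvariant fun z => MvPolynomial.eval z (genericEsymm n k) := by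
  rw [isConjInvariant_iff]
  intro u A
  rw [eval_genericEsymm, eval_genericEsymm, ← Matrix.neg_mul, ← Matrix.mul_neg, mul_assoc,
    Matrix.charpoly_mul_comm, mul_assoc, ← Submonoid.coe_mul]
  simp

/-- Chevalley restriction for `GL_n`: every symmetric polynomial is the restriction of an invariant
polynomial. -/
theorem exists_restrictDiag_eq {n : ℕ} {Q : MvPolynomial (Fin n) ℂ} (hQ : Q.IsSymmetric) :
    ∃ B : MvPolynomial (Fin n × Fin n) ℂ,
      (IsConjInvariant fun z => MvPolynomial.eval z B) ∧ restrictDiag B = Q := by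
  obtain ⟨p, hp⟩ := MvPolynomial.esymmAlgHom_surjective (σ := Fin n) ℂ (n := n) (by simp) ⟨Q, hQ⟩
  refine ⟨MvPolynomial.aeval (fun i : Fin n => genericEsymm n (i + 1)) p, ?_, ?_⟩
  · rw [isConjInvariant_eval_iff]
    intro u
    rw [← AlgHom.comp_apply, MvPolynomial.comp_aeval]
    congr 2
    funext i
    exact isConjInvariant_eval_iff _ |>.mp (isConjInvariant_genericEsymm n (i + 1)) u
  · have hp' := congrArg Subtype.val hp
    rw [MvPolynomial.esymmAlgHom_apply] at hp'
    refine Eq.trans ?_ hp'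
    rw [restrictDiag, ← AlgHom.comp_apply,
      MvPolynomial.comp_aeval]
    congr 2
    funext i
    exact restrictDiag_genericEsymm n (i + 1) i.2

/-- Every alternating polynomial is the Vandermonde product times the restriction of an invariant
polynomial. -/
theorem exists_invariant_of_alternating {n : ℕ} (P : MvPolynomial (Fin n) ℂ)
    (hP : ∀ σ : Equiv.Perm (Fin n), MvPolynomial.rename σ P =
      ((Equiv.Perm.sign σ : ℤ) : MvPolynomial (Fin n) ℂ) * P) :
    ∃ B : MvPolynomial (Fin n × Fin n) ℂ,
      (IsConjInvariant fun z => MvPolynomial.eval z B) ∧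
        P = vandermondePoly n * restrictDiag B := by
  obtain ⟨Q, hQ, rfl⟩ := exists_symmetric_of_alternating P hP
  obtain ⟨B, hB, rfl⟩ := exists_restrictDiag_eq hQ
  exact ⟨B, hB, rfl⟩

/-- The Vandermonde determinant is a signed sum of `n!` distinct monomials, each of squared norm
`∏_{i < n} i!`. -/
theorem fischer_vandermondePoly (n : ℕ) :
    fischer (vandermondePoly n) (vandermondePoly n) =
      ((∏ p ∈ Finset.Icc 1 n, (p ! : ℝ) : ℝ) : ℂ) := by
  classical
  -- the exponent of the monomial which `σ` contributes to the determinant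
  let m : Equiv.Perm (Fin n) → Fin n →₀ ℕ := fun σ =>
    Finsupp.equivFunOnFinite.symm fun i => ((σ⁻¹ i : Fin n) : ℕ)
  have hm : Function.Injective m := fun σ τ h => by
    rw [← inv_inj]
    ext i
    exact DFunLike.congr_fun h i
  have hmf : ∀ σ, ∏ i, (m σ i)! = ∏ i : Fin n, (i : ℕ)! := fun σ =>
    Equiv.prod_comp σ⁻¹ fun i : Fin n => (i : ℕ)!
  have hΔ : vandermondePoly n =
      ∑ σ : Equiv.Perm (Fin n), MvPolynomial.monomial (m σ) ((Equiv.Perm.sign σ : ℤ) : ℂ) := by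
    rw [vandermondePoly, vandermondeProd_eq_det, Matrix.det_apply']
    refine Finset.sum_congr rfl fun σ _ => ?_
    rw [MvPolynomial.monomial_eq, Finsupp.prod_fintype _ _ (fun i => pow_zero _)]
    congr 1
    rw [← Equiv.prod_comp σ fun i => (MvPolynomial.X i : MvPolynomial (Fin n) ℂ) ^ m σ i]
    exact Finset.prod_congr rfl fun i _ => by simp [m, Matrix.vandermonde_apply]
  have hcoeff : ∀ σ, (vandermondePoly n).coeff (m σ) = ((Equiv.Perm.sign σ : ℤ) : ℂ) := by
    intro σ
    rw [hΔ, MvPolynomial.coeff_sum, Finset.sum_eq_single σ]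
    · simp
    · intro τ _ h
      rw [MvPolynomial.coeff_monomial, if_neg fun h' => h (hm h')]
    · simp
  have hsum : ∀ (s : Finset (Equiv.Perm (Fin n))) (G : MvPolynomial (Fin n) ℂ),
      fischer (∑ σ ∈ s, MvPolynomial.monomial (m σ) ((Equiv.Perm.sign σ : ℤ) : ℂ)) G =
      ∑ σ ∈ s, fischer (MvPolynomial.monomial (m σ) ((Equiv.Perm.sign σ : ℤ) : ℂ)) G :=
    fun s G => map_sum (AddMonoidHom.mk' (fun F => fischer F G)
      fun F H => fischer_add_left F H G) _ s
  conv_lhs => rw [hΔ, hsum, ← hΔ]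
  have hterm : ∀ σ ∈ Finset.univ,
      fischer (MvPolynomial.monomial (m σ) ((Equiv.Perm.sign σ : ℤ) : ℂ)) (vandermondePoly n) =
        ((∏ i : Fin n, (i : ℕ)! : ℕ) : ℂ) := by
    intro σ _
    rw [fischer_monomial_left, hcoeff, hmf]
    rcases Int.units_eq_one_or (Equiv.Perm.sign σ) with h | h <;> simp [h]
  rw [Finset.sum_congr rfl hterm, Finset.sum_const, Finset.card_univ, Fintype.card_perm,
    Fintype.card_fin, nsmul_eq_mul, ← Nat.cast_mul]
  -- shift the index: `n! · 0! ⋯ (n - 1)! = 1! ⋯ n!`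
  have hN : n ! * ∏ i : Fin n, (i : ℕ)! = ∏ p ∈ Finset.Icc 1 n, p ! := by
    rw [Fin.prod_univ_eq_prod_range (fun i => i !), mul_comm, ← Finset.prod_range_succ,
      Finset.prod_range_succ', Nat.factorial_zero, mul_one, Finset.range_eq_Ico,
      Finset.prod_Ico_add' (fun p => p !) 0 n 1]
    exact Finset.prod_congr (by ext; simp) fun _ _ => rfl
  rw [hN]
  push_cast
  rfl

/-! ### Gaussian integrals of polynomials -/

theorem eval_smul_of_isHomogeneous {ι : Type} [Fintype ι] {P : MvPolynomial ι ℂ} {k : ℕ}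
    (hP : P.IsHomogeneous k) (t : ℂ) (z : ι → ℂ) :
    MvPolynomial.eval (t • z) P = t ^ k * MvPolynomial.eval z P := by
  rw [MvPolynomial.eval_eq', MvPolynomial.eval_eq', Finset.mul_sum]
  refine Finset.sum_congr rfl fun μ hμ => ?_
  have hd : ∑ i, μ i = k := by
    rw [hP.degree_eq_sum_deg_support hμ]
    exact (Finset.sum_subset (Finset.subset_univ _) fun i _ hi => by simpa using hi).symm
  simp only [Pi.smul_apply, smul_eq_mul, mul_pow, Finset.prod_mul_distrib]
  rw [Finset.prod_pow_eq_pow_sum, hd]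
  ring

/-- Distinct powers of `z` are orthogonal for the Gaussian weight, by rotation invariance. -/
theorem integral_conj_pow_mul_pow_mul_exp_of_ne {a b : ℕ} (hab : a ≠ b) :
    ∫ z : ℂ, starRingEnd ℂ z ^ a * z ^ b * (Real.exp (-‖z‖ ^ 2) : ℂ) = 0 := by
  set I := ∫ z : ℂ, starRingEnd ℂ z ^ a * z ^ b * (Real.exp (-‖z‖ ^ 2) : ℂ) with hI
  -- the rotation by the angle `1` multiplies the integral by `exp(i (b - a)) ≠ 1`
  have h1 : I = Complex.exp ((((b : ℤ) - (a : ℤ) : ℤ) : ℂ) * Complex.I) * I := by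
    have h := (rotation (Circle.exp 1)).measurePreserving.integral_comp
      (rotation (Circle.exp 1)).toHomeomorph.measurableEmbedding
      (fun z : ℂ => starRingEnd ℂ z ^ a * z ^ b * (Real.exp (-‖z‖ ^ 2) : ℂ))
    conv_lhs => rw [hI, ← h]
    rw [hI, ← integral_const_mul]
    refine integral_congr_ae (Filter.Eventually.of_forall fun z => ?_)
    have he : Complex.exp ((((b : ℤ) - (a : ℤ) : ℤ) : ℂ) * Complex.I) =
        starRingEnd ℂ (Complex.exp Complex.I) ^ a * Complex.exp Complex.I ^ b := by
      rw [← Complex.exp_conj, ← Complex.exp_nat_mul, ← Complex.exp_nat_mul, ← Complex.exp_add,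
        Complex.conj_I]
      congr 1
      push_cast
      ring
    have hn : ‖Complex.exp Complex.I‖ = 1 := by simpa using Complex.norm_exp_ofReal_mul_I 1
    simp only [rotation_apply, Circle.coe_exp, Complex.ofReal_one, one_mul, map_mul, norm_mul, he,
      hn]
    ring
  by_contra hne
  have h2 : Complex.exp ((((b : ℤ) - (a : ℤ) : ℤ) : ℂ) * Complex.I) = 1 :=
    mul_right_cancel₀ hne (h1.symm.trans (one_mul I).symm)
  -- otherwise `b - a` is a multiple of `2π`, contradicting the irrationality of `π`
  obtain ⟨m, hm⟩ := Complex.exp_eq_one_iff.mp h2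
  have h3 : (((b : ℤ) - (a : ℤ) : ℤ) : ℝ) = m * (2 * Real.pi) := by
    have := congrArg Complex.im hm
    simpa using this
  have hm0 : m ≠ 0 := by
    rintro rfl
    simp only [Int.cast_zero, zero_mul] at h3
    have : (b : ℤ) - a = 0 := by exact_mod_cast h3
    omega
  refine irrational_pi ⟨(((b : ℤ) - (a : ℤ) : ℤ) : ℚ) / (2 * m), ?_⟩
  have : (m : ℝ) ≠ 0 := by exact_mod_cast hm0
  push_cast at h3 ⊢
  rw [h3]
  field_simp

theorem integral_norm_pow_mul_exp (k : ℕ) :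
    ∫ z : ℂ, ‖z‖ ^ k * Real.exp (-‖z‖ ^ 2) = Real.pi * Real.Gamma ((k + 2) / 2) := by
  have h := Complex.integral_rpow_mul_exp_neg_rpow (p := 2) (q := k) one_le_two
    (by have : (0 : ℝ) ≤ k := Nat.cast_nonneg k; linarith)
  rw [mul_div_cancel_left₀ _ (two_ne_zero)] at h
  rw [← h]
  congr 1
  funext z
  norm_cast

theorem integrable_norm_pow_mul_exp (k : ℕ) :
    Integrable fun z : ℂ => ‖z‖ ^ k * Real.exp (-‖z‖ ^ 2) := by
  -- a function with nonzero integral is integrable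
  refine Integrable.of_integral_ne_zero ?_
  rw [integral_norm_pow_mul_exp]
  have : 0 < Real.Gamma (((k : ℝ) + 2) / 2) := Real.Gamma_pos_of_pos (by positivity)
  positivity

theorem integrable_conj_pow_mul_pow_mul_exp (a b : ℕ) :
    Integrable fun z : ℂ => starRingEnd ℂ z ^ a * z ^ b * (Real.exp (-‖z‖ ^ 2) : ℂ) := by
  refine (integrable_norm_pow_mul_exp (a + b)).mono' ?_ (Filter.Eventually.of_forall fun z => ?_)
  · exact Continuous.aestronglyMeasurable (by fun_prop)
  · rw [norm_mul, norm_mul, norm_pow, norm_pow, RCLike.norm_conj, Complex.norm_real,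
      Real.norm_of_nonneg (Real.exp_pos _).le, pow_add]

theorem integral_conj_pow_mul_pow_mul_exp (a b : ℕ) :
    ∫ z : ℂ, starRingEnd ℂ z ^ a * z ^ b * (Real.exp (-‖z‖ ^ 2) : ℂ) =
      if a = b then (Real.pi : ℂ) * (a ! : ℂ) else 0 := by
  split_ifs with hab
  · subst hab
    have h := integral_norm_pow_mul_exp (2 * a)
    rw [show (((2 * a : ℕ) : ℝ) + 2) / 2 = a + 1 by push_cast; ring, Real.Gamma_nat_eq_factorial]
      at h
    rw [← Complex.ofReal_natCast, ← Complex.ofReal_mul, ← h, ← integral_complex_ofReal]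
    refine integral_congr_ae (Filter.Eventually.of_forall fun z => ?_)
    simp only [← mul_pow, mul_comm (starRingEnd ℂ z), Complex.mul_conj, Complex.normSq_eq_norm_sq]
    push_cast
    rw [pow_mul]
  · exact integral_conj_pow_mul_pow_mul_exp_of_ne hab

theorem monomial_gaussian_eq_prod {ι : Type} [Fintype ι] (μ ν : ι →₀ ℕ) (z : ι → ℂ) :
    starRingEnd ℂ (∏ i, z i ^ μ i) * (∏ i, z i ^ ν i) * (Real.exp (-∑ i, ‖z i‖ ^ 2) : ℂ) =
      ∏ i, (starRingEnd ℂ (z i) ^ μ i * z i ^ ν i * (Real.exp (-‖z i‖ ^ 2) : ℂ)) := by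
  rw [← Finset.sum_neg_distrib, Real.exp_sum, Finset.prod_mul_distrib, Finset.prod_mul_distrib,
    map_prod]
  simp

theorem integrable_monomial_gaussian {ι : Type} [Fintype ι] (μ ν : ι →₀ ℕ) :
    Integrable fun z : ι → ℂ =>
      starRingEnd ℂ (∏ i, z i ^ μ i) * (∏ i, z i ^ ν i) *
        (Real.exp (-∑ i, ‖z i‖ ^ 2) : ℂ) := by
  simp only [monomial_gaussian_eq_prod]
  exact Integrable.fintype_prod (f := fun i z => starRingEnd ℂ z ^ μ i * z ^ ν i *
    (Real.exp (-‖z‖ ^ 2) : ℂ)) fun i => integrable_conj_pow_mul_pow_mul_exp _ _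

theorem integral_monomial_gaussian {ι : Type} [Fintype ι] [DecidableEq ι] (μ ν : ι →₀ ℕ) :
    ∫ z : ι → ℂ, starRingEnd ℂ (∏ i, z i ^ μ i) * (∏ i, z i ^ ν i) *
        (Real.exp (-∑ i, ‖z i‖ ^ 2) : ℂ) =
      if μ = ν then (Real.pi : ℂ) ^ Fintype.card ι * ((∏ i, (μ i)! : ℕ) : ℂ) else 0 := by
  simp only [monomial_gaussian_eq_prod]
  rw [integral_fintype_prod_volume_eq_prod (f := fun i z => starRingEnd ℂ z ^ μ i * z ^ ν i *
    (Real.exp (-‖z‖ ^ 2) : ℂ))]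
  simp only [integral_conj_pow_mul_pow_mul_exp]
  split_ifs with h
  · subst h
    simp [Finset.prod_mul_distrib]
  · obtain ⟨i, hi⟩ := DFunLike.ne_iff.mp h
    exact Finset.prod_eq_zero (Finset.mem_univ i) (if_neg hi)

theorem eval_gaussian_eq_sum {ι : Type} [Fintype ι] (F G : MvPolynomial ι ℂ) (z : ι → ℂ) :
    starRingEnd ℂ (MvPolynomial.eval z F) * MvPolynomial.eval z G *
        (Real.exp (-∑ i, ‖z i‖ ^ 2) : ℂ) =
      ∑ μ ∈ F.support, ∑ ν ∈ G.support, starRingEnd ℂ (F.coeff μ) * G.coeff ν *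
        (starRingEnd ℂ (∏ i, z i ^ μ i) * (∏ i, z i ^ ν i) *
          (Real.exp (-∑ i, ‖z i‖ ^ 2) : ℂ)) := by
  rw [MvPolynomial.eval_eq', MvPolynomial.eval_eq', map_sum, Finset.sum_mul_sum, Finset.sum_mul]
  refine Finset.sum_congr rfl fun μ _ => ?_
  rw [Finset.sum_mul]
  refine Finset.sum_congr rfl fun ν _ => ?_
  rw [map_mul]
  ring

theorem integrable_eval_gaussian {ι : Type} [Fintype ι] (F G : MvPolynomial ι ℂ) :
    Integrable fun z : ι → ℂ => starRingEnd ℂ (MvPolynomial.eval z F) * MvPolynomial.eval z G *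
        (Real.exp (-∑ i, ‖z i‖ ^ 2) : ℂ) := by
  simp only [eval_gaussian_eq_sum]
  exact integrable_finsetSum _ fun μ _ => integrable_finsetSum _ fun ν _ =>
    (integrable_monomial_gaussian μ ν).const_mul _

/-- On polynomials, the inner product of the Segal-Bargmann space is the Fischer inner product. -/
theorem sbInner_eval {ι : Type} [Fintype ι] (F G : MvPolynomial ι ℂ) :
    sbInner (fun z => MvPolynomial.eval z F) (fun z => MvPolynomial.eval z G) = fischer F G := by
  classical
  simp only [sbInner, eval_gaussian_eq_sum]
  rw [integral_finsetSum _ fun μ _ => integrable_finsetSum _ fun ν _ =>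
    (integrable_monomial_gaussian μ ν).const_mul _, Finset.mul_sum, fischer]
  refine Finset.sum_congr rfl fun μ _ => ?_
  rw [integral_finsetSum _ fun ν _ => (integrable_monomial_gaussian μ ν).const_mul _]
  simp only [integral_const_mul, integral_monomial_gaussian, mul_ite, mul_zero,
    Finset.sum_ite_eq]
  have hpi : (Real.pi : ℂ) ^ Fintype.card ι ≠ 0 :=
    pow_ne_zero _ (Complex.ofReal_ne_zero.mpr Real.pi_ne_zero)
  split_ifs with h
  · field_simp
  · rw [MvPolynomial.notMem_support_iff.mp h]
    simp

theorem differentiable_eval {ι : Type} [Fintype ι] (F : MvPolynomial ι ℂ) :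
    Differentiable ℂ fun z : ι → ℂ => MvPolynomial.eval z F := by
  simp only [MvPolynomial.eval_eq']
  fun_prop

theorem eval_mem_segalBargmann {ι : Type} [Fintype ι] (F : MvPolynomial ι ℂ) :
    (fun z : ι → ℂ => MvPolynomial.eval z F) ∈ segalBargmann ι := by
  refine ⟨differentiable_eval F, (integrable_eval_gaussian F F).norm.congr
    (Filter.Eventually.of_forall fun z => ?_)⟩
  simp only [norm_mul, RCLike.norm_conj, Complex.norm_real,
    Real.norm_of_nonneg (Real.exp_pos _).le]
  ring

theorem isInvariantPoly_iff {n : ℕ} (F : MvPolynomial (Fin n × Fin n) ℂ) :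
    IsInvariantPoly F ↔ IsConjInvariant fun z => MvPolynomial.eval z F := by
  rw [isConjInvariant_iff]
  exact ⟨fun h => h.2, fun h => ⟨eval_mem_segalBargmann F, h⟩⟩

/-! ### The Gaussian measure -/

/-- The (unnormalised) Gaussian measure `exp(-|z|²) dz`. -/
def gaussianMeas (ι : Type) [Fintype ι] : Measure (ι → ℂ) :=
  volume.withDensity fun z => ENNReal.ofReal (Real.exp (-∑ i, ‖z i‖ ^ 2))

theorem measurable_gaussian (ι : Type) [Fintype ι] :
    Measurable fun z : ι → ℂ => ENNReal.ofReal (Real.exp (-∑ i, ‖z i‖ ^ 2)) := by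
  fun_prop

theorem sbInner_eq_integral_gaussianMeas {ι : Type} [Fintype ι] (F G : (ι → ℂ) → ℂ) :
    sbInner F G = ((Real.pi : ℂ) ^ Fintype.card ι)⁻¹ *
      ∫ z, starRingEnd ℂ (F z) * G z ∂gaussianMeas ι := by
  rw [sbInner, gaussianMeas, integral_withDensity_eq_integral_toReal_smul (measurable_gaussian ι)
    (Filter.Eventually.of_forall fun _ => ENNReal.ofReal_lt_top)]
  congr 2
  funext z
  rw [ENNReal.toReal_ofReal (Real.exp_pos _).le, Complex.real_smul, mul_comm]

theorem mem_segalBargmann_iff {ι : Type} [Fintype ι] (F : (ι → ℂ) → ℂ) :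
    F ∈ segalBargmann ι ↔ Differentiable ℂ F ∧ MemLp F 2 (gaussianMeas ι) := by
  refine and_congr_right fun hF => ?_
  rw [memLp_two_iff_integrable_sq_norm hF.continuous.aestronglyMeasurable, gaussianMeas,
    integrable_withDensity_iff_integrable_smul' (measurable_gaussian ι)
    (Filter.Eventually.of_forall fun _ => ENNReal.ofReal_lt_top)]
  refine integrable_congr (Filter.Eventually.of_forall fun z => ?_)
  dsimp only
  rw [ENNReal.toReal_ofReal (Real.exp_pos _).le, smul_eq_mul, mul_comm]

instance isFiniteMeasure_gaussianMeas (ι : Type) [Fintype ι] :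
    IsFiniteMeasure (gaussianMeas ι) := by
  refine isFiniteMeasure_withDensity_ofReal ?_
  have h := (eval_mem_segalBargmann (1 : MvPolynomial ι ℂ)).2.2
  simpa using h

/-- The squared norm of the Segal-Bargmann space before normalisation, with values in
`[0, ∞]`. -/
def gaussNormSq {ι : Type} [Fintype ι] (F : (ι → ℂ) → ℂ) : ENNReal :=
  ∫⁻ z, ‖F z‖ₑ ^ 2 ∂gaussianMeas ι

theorem eLpNorm_sq_eq_gaussNormSq {ι : Type} [Fintype ι] (F : (ι → ℂ) → ℂ) :
    eLpNorm F 2 (gaussianMeas ι) ^ 2 = gaussNormSq F := by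
  have h := eLpNorm_nnreal_pow_eq_lintegral (μ := gaussianMeas ι) (f := F) (p := 2) two_ne_zero
  simpa [gaussNormSq] using h

theorem mem_segalBargmann_iff_gaussNormSq {ι : Type} [Fintype ι] (F : (ι → ℂ) → ℂ) :
    F ∈ segalBargmann ι ↔ Differentiable ℂ F ∧ gaussNormSq F ≠ ⊤ := by
  rw [mem_segalBargmann_iff]
  refine and_congr_right fun hF => ?_
  rw [MemLp, ← eLpNorm_sq_eq_gaussNormSq]
  simp [hF.continuous.aestronglyMeasurable, lt_top_iff_ne_top]

theorem gaussNormSq_eval {ι : Type} [Fintype ι] (F : MvPolynomial ι ℂ) :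
    gaussNormSq (fun z => MvPolynomial.eval z F) =
      ENNReal.ofReal (Real.pi ^ Fintype.card ι * fischerNormSq F) := by
  have hL := ((mem_segalBargmann_iff _).mp (eval_mem_segalBargmann F))
  have hi := (memLp_two_iff_integrable_sq_norm hL.1.continuous.aestronglyMeasurable).mp hL.2
  have h := sbInner_eval F F
  rw [sbInner_eq_integral_gaussianMeas, fischer_self] at h
  have hpi : (Real.pi : ℂ) ^ Fintype.card ι ≠ 0 :=
    pow_ne_zero _ (Complex.ofReal_ne_zero.mpr Real.pi_ne_zero)
  rw [inv_mul_eq_iff_eq_mul₀ hpi] at h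
  have h2 : ∫ z, ‖MvPolynomial.eval z F‖ ^ 2 ∂gaussianMeas ι =
      Real.pi ^ Fintype.card ι * fischerNormSq F := by
    rw [← Complex.ofReal_inj, ← integral_complex_ofReal]
    push_cast
    rw [← h]
    refine integral_congr_ae (Filter.Eventually.of_forall fun z => ?_)
    simp only [mul_comm (starRingEnd ℂ _), Complex.mul_conj, Complex.normSq_eq_norm_sq]
    push_cast
    rfl
  rw [← h2, gaussNormSq, ofReal_integral_eq_lintegral_ofReal hi
    (Filter.Eventually.of_forall fun z => by positivity)]
  refine lintegral_congr fun z => ?_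
  rw [← ofReal_norm, ENNReal.ofReal_pow (norm_nonneg _)]

/-- The Gaussian measure is invariant under the rotations `z ↦ w z`, `|w| = 1`. -/
theorem lintegral_gaussianMeas_smul {ι : Type} [Fintype ι] {w : ℂ} (hw : ‖w‖ = 1)
    {h : (ι → ℂ) → ENNReal} (hh : Measurable h) :
    ∫⁻ z, h (w • z) ∂gaussianMeas ι = ∫⁻ z, h z ∂gaussianMeas ι := by
  have hhw : Measurable fun z : ι → ℂ => h (w • z) := hh.comp (measurable_const_smul w)
  rw [gaussianMeas, lintegral_withDensity_eq_lintegral_mul _ (measurable_gaussian ι) hhw,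
    lintegral_withDensity_eq_lintegral_mul _ (measurable_gaussian ι) hh]
  have hmp : MeasurePreserving (fun z : ι → ℂ => w • z) volume volume :=
    volume_preserving_pi (ι := ι)
      (f := fun _ => rotation ⟨w, mem_sphere_zero_iff_norm.mpr hw⟩)
      fun _ => (rotation ⟨w, mem_sphere_zero_iff_norm.mpr hw⟩).measurePreserving
  rw [← hmp.lintegral_comp ((measurable_gaussian ι).mul hh)]
  refine lintegral_congr fun z => ?_
  simp [hw]

/-! ### The kernel bound -/

/-- Partial sums of the product of exponential series are bounded by the exponential. -/
theorem sum_prod_pow_div_factorial_le_exp {ι : Type} [Fintype ι] (s : Finset (ι →₀ ℕ))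
    (x : ι → ℝ) (hx : ∀ i, 0 ≤ x i) :
    ∑ μ ∈ s, ∏ i, (x i ^ μ i / (μ i)!) ≤ Real.exp (∑ i, x i) := by
  classical
  set N := s.sup (fun μ => μ.degree) + 1
  have h1 : ∑ μ ∈ s, ∏ i, (x i ^ μ i / (μ i)!) =
      ∑ μ ∈ s.map ⟨fun μ : ι →₀ ℕ => (μ : ι → ℕ), DFunLike.coe_injective⟩,
        ∏ i, (x i ^ μ i / (μ i)!) := by
    rw [Finset.sum_map]
    rfl
  have h2 : s.map ⟨fun μ : ι →₀ ℕ => (μ : ι → ℕ), DFunLike.coe_injective⟩ ⊆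
      Fintype.piFinset fun _ => Finset.range N := by
    intro f hf
    obtain ⟨μ, hμ, rfl⟩ := Finset.mem_map.mp hf
    refine Fintype.mem_piFinset.mpr fun i => Finset.mem_range.mpr (Nat.lt_succ_of_le ?_)
    exact (Finsupp.le_degree i μ).trans (Finset.le_sup (f := fun μ : ι →₀ ℕ => μ.degree) hμ)
  rw [h1, Real.exp_sum]
  calc _ ≤ ∑ μ ∈ Fintype.piFinset fun _ : ι => Finset.range N, ∏ i, (x i ^ μ i / (μ i)!) :=
        Finset.sum_le_sum_of_subset_of_nonneg h2 fun μ _ _ =>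
          Finset.prod_nonneg fun i _ => div_nonneg (pow_nonneg (hx i) _) (Nat.cast_nonneg _)
    _ = ∏ i, ∑ k ∈ Finset.range N, x i ^ k / k ! := by
        rw [Finset.prod_univ_sum]
    _ ≤ ∏ i, Real.exp (x i) :=
        Finset.prod_le_prod (fun i _ => Finset.sum_nonneg fun k _ =>
          div_nonneg (pow_nonneg (hx i) _) (Nat.cast_nonneg _))
          fun i _ => Real.sum_le_exp_of_nonneg (hx i) N

/-- The reproducing kernel bound `|P(z)|² ≤ ‖P‖² exp(|z|²)`. -/
theorem norm_eval_sq_le {ι : Type} [Fintype ι] (P : MvPolynomial ι ℂ) (z : ι → ℂ) :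
    ‖MvPolynomial.eval z P‖ ^ 2 ≤ fischerNormSq P * Real.exp (∑ i, ‖z i‖ ^ 2) := by
  have hf : ∀ μ : ι →₀ ℕ, (0 : ℝ) < ((∏ i, (μ i)! : ℕ) : ℝ) := fun μ => by
    exact_mod_cast Finset.prod_pos fun i _ => Nat.factorial_pos _
  -- weights for the Cauchy-Schwarz inequality
  have h1 : ‖MvPolynomial.eval z P‖ ≤ ∑ μ ∈ P.support,
      (‖P.coeff μ‖ * Real.sqrt ((∏ i, (μ i)! : ℕ) : ℝ)) *
        (‖∏ i, z i ^ μ i‖ / Real.sqrt ((∏ i, (μ i)! : ℕ) : ℝ)) := by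
    rw [MvPolynomial.eval_eq']
    refine (norm_sum_le _ _).trans (Finset.sum_le_sum fun μ _ => ?_)
    rw [norm_mul]
    have := Real.sqrt_pos.mpr (hf μ)
    field_simp
    exact le_rfl
  calc ‖MvPolynomial.eval z P‖ ^ 2 ≤ _ := pow_le_pow_left₀ (norm_nonneg _) h1 2
    _ ≤ _ := Finset.sum_mul_sq_le_sq_mul_sq _ _ _
    _ ≤ _ := by
      refine mul_le_mul ?_ ?_ (Finset.sum_nonneg fun _ _ => sq_nonneg _) (fischerNormSq_nonneg P)
      · refine (Finset.sum_congr rfl fun μ _ => ?_).le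
        rw [mul_pow, Real.sq_sqrt (hf μ).le]
      · refine le_of_eq_of_le (Finset.sum_congr rfl fun μ _ => ?_)
          (sum_prod_pow_div_factorial_le_exp P.support (fun i => ‖z i‖ ^ 2)
            fun i => sq_nonneg _)
        rw [div_pow, Real.sq_sqrt (hf μ).le, Finset.prod_div_distrib, norm_prod,
          ← Finset.prod_pow, Nat.cast_prod]
        congr 1
        exact Finset.prod_congr rfl fun i _ => by rw [norm_pow, ← pow_mul, ← pow_mul, mul_comm]

/-! ### Homogeneous expansions and Parseval's identity -/

/-- Parseval's identity on the circle, for an absolutely convergent Fourier series. -/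
theorem lintegral_enorm_sq_tsum_fourier {a : ℕ → ℂ} (ha : Summable fun k => ‖a k‖) :
    ∫⁻ t : AddCircle (1 : ℝ), ‖∑' k : ℕ, a k * fourier (k : ℤ) t‖ₑ ^ 2 ∂AddCircle.haarAddCircle =
      ∑' k, ‖a k‖ₑ ^ 2 := by
  have hsum : Summable fun k : ℕ => a k • (fourier (k : ℤ) : C(AddCircle (1 : ℝ), ℂ)) := by
    refine Summable.of_norm (ha.congr fun k => ?_)
    rw [norm_smul, fourier_norm, mul_one]
  set f : C(AddCircle (1 : ℝ), ℂ) := ∑' k : ℕ, a k • fourier (k : ℤ) with hf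
  have hfa : ∀ t, f t = ∑' k : ℕ, a k * fourier (k : ℤ) t := by
    intro t
    exact (ContinuousMap.tsum_apply hsum t).symm
  set T := ContinuousMap.toLp (E := ℂ) 2 (AddCircle.haarAddCircle (T := (1 : ℝ))) ℂ with hT
  have hL : HasSum (fun k : ℕ => a k • fourierLp (T := (1 : ℝ)) 2 (k : ℤ)) (T f) := by
    have := hsum.hasSum.mapL T
    simpa only [map_smul] using this
  have hcoef : ∀ k : ℕ, inner ℂ (fourierLp (T := (1 : ℝ)) 2 (k : ℤ)) (T f) = a k := by
    intro k
    have h1 := hL.mapL (innerSL ℂ (fourierLp (T := (1 : ℝ)) 2 (k : ℤ)))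
    have h2 : HasSum (fun j : ℕ => if j = k then a k else 0) (a k) := hasSum_ite_eq k (a k)
    refine h1.unique (h2.congr_fun fun j => ?_)
    rw [innerSL_apply_apply, inner_smul_right, orthonormal_iff_ite.mp orthonormal_fourier]
    by_cases h : j = k
    · simp [h]
    · have : (k : ℤ) ≠ j := by exact_mod_cast Ne.symm h
      simp [h, this]
  have hnorm : HasSum (fun k : ℕ => ‖a k‖ ^ 2) (‖T f‖ ^ 2) := by
    have h1 := hL.mapL (innerSL ℂ (T f))
    rw [innerSL_apply_apply, inner_self_eq_norm_sq_to_K] at h1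
    have h2 := Complex.hasSum_re h1
    convert h2 using 2 with k
    · rw [innerSL_apply_apply, inner_smul_right, ← inner_conj_symm, hcoef, Complex.mul_conj,
        Complex.ofReal_re, Complex.normSq_eq_norm_sq]
    · norm_cast
  have hlhs : ∫⁻ t : AddCircle (1 : ℝ), ‖∑' k : ℕ, a k * fourier (k : ℤ) t‖ₑ ^ 2
      ∂AddCircle.haarAddCircle = ‖T f‖ₑ ^ 2 := by
    rw [Lp.enorm_def]
    have h := eLpNorm_nnreal_pow_eq_lintegral (μ := AddCircle.haarAddCircle (T := (1 : ℝ)))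
      (f := (T f : AddCircle (1 : ℝ) → ℂ)) (p := 2) two_ne_zero
    have h' : eLpNorm (T f : AddCircle (1 : ℝ) → ℂ) 2 AddCircle.haarAddCircle ^ 2 =
        ∫⁻ t, ‖(T f : AddCircle (1 : ℝ) → ℂ) t‖ₑ ^ 2 ∂AddCircle.haarAddCircle := by
      simpa using h
    rw [h']
    refine lintegral_congr_ae ?_
    filter_upwards [ContinuousMap.coeFn_toLp (p := 2) (𝕜 := ℂ)
      (AddCircle.haarAddCircle (T := (1 : ℝ))) f] with t ht
    rw [ht, hfa]
  rw [hlhs]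
  have h3 : ∀ k, ‖a k‖ₑ ^ 2 = ENNReal.ofReal (‖a k‖ ^ 2) := fun k => by
    rw [ENNReal.ofReal_pow (norm_nonneg _), ofReal_norm]
  simp only [h3]
  rw [← ENNReal.ofReal_tsum_of_nonneg (fun k => sq_nonneg _) hnorm.summable, hnorm.tsum_eq,
    ENNReal.ofReal_pow (norm_nonneg _), ofReal_norm]

/-- Parseval's identity for a homogeneous expansion: the components of different degrees are
orthogonal, by averaging over the scalar rotations `z ↦ w z`, `|w| = 1`. -/
theorem gaussNormSq_eq_tsum {ι : Type} [Fintype ι] {d : ℕ} {P : ℕ → MvPolynomial ι ℂ}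
    (hP : ∀ k, (P k).IsHomogeneous (d + k)) {F : (ι → ℂ) → ℂ} (hF : Continuous F)
    (hsum : ∀ z, HasSum (fun k => MvPolynomial.eval z (P k)) (F z)) :
    gaussNormSq F = ∑' k, gaussNormSq fun z => MvPolynomial.eval z (P k) := by
  have hw : ∀ t : AddCircle (1 : ℝ), ‖fourier 1 t‖ = 1 := fun t => by
    rw [fourier_apply]
    exact Circle.norm_coe _
  have h1 : ∀ t : AddCircle (1 : ℝ),
      ∫⁻ z, ‖F (fourier 1 t • z)‖ₑ ^ 2 ∂gaussianMeas ι = gaussNormSq F := fun t =>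
    lintegral_gaussianMeas_smul (hw t) (h := fun z => ‖F z‖ₑ ^ 2)
      (by have := hF.measurable; fun_prop)
  have h2 : gaussNormSq F = ∫⁻ t : AddCircle (1 : ℝ),
      ∫⁻ z, ‖F (fourier 1 t • z)‖ₑ ^ 2 ∂gaussianMeas ι ∂AddCircle.haarAddCircle := by
    simp only [h1, lintegral_const, measure_univ, mul_one]
  have hcont : Continuous fun p : AddCircle (1 : ℝ) × (ι → ℂ) => F (fourier 1 p.1 • p.2) := by
    have := (fourier 1 : C(AddCircle (1 : ℝ), ℂ)).continuous
    fun_prop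
  rw [h2, lintegral_lintegral_swap]
  · have h3 : ∀ z : ι → ℂ, ∫⁻ t : AddCircle (1 : ℝ), ‖F (fourier 1 t • z)‖ₑ ^ 2
        ∂AddCircle.haarAddCircle = ∑' k, ‖MvPolynomial.eval z (P k)‖ₑ ^ 2 := by
      intro z
      rw [← lintegral_enorm_sq_tsum_fourier (hsum z).summable.norm]
      refine lintegral_congr fun t => ?_
      congr 1
      have hk : ∀ k : ℕ, (fourier (k : ℤ) t : ℂ) = fourier 1 t ^ k := fun k => by
        rw [fourier_apply, fourier_apply, AddCircle.toCircle_zsmul, one_zsmul, zpow_natCast,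
          Circle.coe_pow]
      have h4 : F (fourier 1 t • z) =
          fourier 1 t ^ d * ∑' k : ℕ, MvPolynomial.eval z (P k) * fourier (k : ℤ) t := by
        rw [← (hsum _).tsum_eq, ← tsum_mul_left]
        refine tsum_congr fun k => ?_
        rw [eval_smul_of_isHomogeneous (hP k), hk, pow_add]
        ring
      rw [h4, enorm_mul, enorm_pow]
      have h5 : ‖(fourier 1 t : ℂ)‖ₑ = 1 := by
        rw [← ofReal_norm, hw, ENNReal.ofReal_one]
      rw [h5, one_pow, one_mul]
    simp only [h3]
    rw [lintegral_tsum]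
    · rfl
    · intro k
      have := (differentiable_eval (P k)).continuous.measurable
      exact Measurable.aemeasurable (by fun_prop)
  · exact (hcont.measurable.enorm.pow_const 2).aemeasurable

/-! ### Summation of homogeneous polynomials -/

/-- Cauchy's estimate on the unit ball around `z`, from the one-dimensional one on complex
lines. -/
theorem norm_fderiv_le_of_forall_norm_le {E : Type*} [NormedAddCommGroup E] [NormedSpace ℂ E]
    {f : E → ℂ} (hf : Differentiable ℂ f) {z : E} {C : ℝ}
    (hC : ∀ w, ‖w - z‖ ≤ 1 → ‖f w‖ ≤ C) : ‖fderiv ℂ f z‖ ≤ C := by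
  have hC0 : 0 ≤ C := (norm_nonneg _).trans (hC z (by simp))
  refine ContinuousLinearMap.opNorm_le_of_unit_norm hC0 fun v hv => ?_
  have hg : HasDerivAt (fun t : ℂ => f (z + t • v)) (fderiv ℂ f z v) 0 := by
    have h1 : HasDerivAt (fun t : ℂ => z + t • v) v 0 := by
      simpa using ((hasDerivAt_id (0 : ℂ)).smul_const v).const_add z
    have h2 : HasFDerivAt f (fderiv ℂ f z) (z + (0 : ℂ) • v) := by
      simpa using (hf z).hasFDerivAt
    exact h2.comp_hasDerivAt (0 : ℂ) h1
  rw [← hg.deriv]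
  have hgd : Differentiable ℂ fun t : ℂ => f (z + t • v) := by fun_prop
  have h := Complex.norm_deriv_le_of_forall_mem_sphere_norm_le (c := 0) (R := 1) (C := C)
    zero_lt_one hgd.diffContOnCl fun t ht => hC _ (by
      rw [add_sub_cancel_left, norm_smul, hv, mul_one]
      exact (mem_sphere_zero_iff_norm.mp ht).le)
  simpa using h

/-- A sum of entire functions which converges normally on bounded sets is entire. -/
theorem differentiable_tsum_of_summable_bound {E : Type*} [NormedAddCommGroup E]
    [NormedSpace ℂ E] {f : ℕ → E → ℂ} (hf : ∀ k, Differentiable ℂ (f k))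
    (hb : ∀ R : ℝ, ∃ u : ℕ → ℝ, Summable u ∧ ∀ k z, ‖z‖ ≤ R → ‖f k z‖ ≤ u k) :
    Differentiable ℂ fun z => ∑' k, f k z := by
  intro z₀
  obtain ⟨u, hu, hle⟩ := hb (‖z₀‖ + 2)
  have hz : ∀ z ∈ Metric.ball z₀ 1, ∀ w, ‖w - z‖ ≤ 1 → ‖w‖ ≤ ‖z₀‖ + 2 := by
    intro z hz w hw
    rw [mem_ball_iff_norm] at hz
    calc ‖w‖ = ‖(w - z) + (z - z₀) + z₀‖ := by congr 1; abel
      _ ≤ ‖w - z‖ + ‖z - z₀‖ + ‖z₀‖ := norm_add₃_le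
      _ ≤ _ := by linarith
  have hz0 : z₀ ∈ Metric.ball z₀ 1 := Metric.mem_ball_self one_pos
  exact (hasFDerivAt_tsum_of_isPreconnected (𝕜 := ℂ) hu Metric.isOpen_ball
    (convex_ball z₀ 1).isPreconnected (fun k z _ => (hf k z).hasFDerivAt)
    (fun k z hz' => norm_fderiv_le_of_forall_norm_le (hf k) fun w hw => hle k w (hz z hz' w hw))
    hz0 (Summable.of_norm_bounded hu fun k => hle k z₀ (by linarith)) hz0).differentiableAt

theorem sum_norm_sq_le {ι : Type} [Fintype ι] {z : ι → ℂ} {R : ℝ} (hz : ‖z‖ ≤ R) :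
    ∑ i, ‖z i‖ ^ 2 ≤ Fintype.card ι * R ^ 2 := by
  have h := Finset.sum_le_card_nsmul Finset.univ (fun i => ‖z i‖ ^ 2) (R ^ 2) fun i _ =>
    pow_le_pow_left₀ (norm_nonneg _) ((norm_le_pi_norm z i).trans hz) 2
  rwa [nsmul_eq_mul, Finset.card_univ] at h

/-- Homogeneous polynomials of increasing degree with bounded norms sum to an entire function. -/
theorem exists_entire_hasSum {ι : Type} [Fintype ι] {P : ℕ → MvPolynomial ι ℂ}
    (hP : ∀ k, (P k).IsHomogeneous k) {M : ℝ} (hM : ∀ k, fischerNormSq (P k) ≤ M) :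
    ∃ F : (ι → ℂ) → ℂ, Differentiable ℂ F ∧
      ∀ z, HasSum (fun k => MvPolynomial.eval z (P k)) (F z) := by
  have hM0 : 0 ≤ M := (fischerNormSq_nonneg (P 0)).trans (hM 0)
  -- the kernel bound at `2 z` gives geometric decay at `z`
  have key : ∀ (R : ℝ) (k : ℕ) (z : ι → ℂ), ‖z‖ ≤ R → ‖MvPolynomial.eval z (P k)‖ ≤
      Real.sqrt (M * Real.exp (Fintype.card ι * (2 * R) ^ 2)) * (1 / 2) ^ k := by
    intro R k z hz
    have h1 := norm_eval_sq_le (P k) ((2 : ℂ) • z)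
    rw [eval_smul_of_isHomogeneous (hP k), norm_mul, norm_pow, Complex.norm_two] at h1
    have h2 : ‖(2 : ℂ) • z‖ ≤ 2 * R := by
      rw [norm_smul, Complex.norm_two]
      linarith
    have h3 : (2 ^ k * ‖MvPolynomial.eval z (P k)‖) ^ 2 ≤
        M * Real.exp (Fintype.card ι * (2 * R) ^ 2) :=
      h1.trans (mul_le_mul (hM k) (Real.exp_le_exp.mpr (sum_norm_sq_le h2))
        (Real.exp_pos _).le hM0)
    have h4 := Real.le_sqrt_of_sq_le h3
    rw [one_div, inv_pow, ← div_eq_mul_inv, le_div_iff₀ (by positivity), mul_comm]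
    exact h4
  have hsummable : ∀ C : ℝ, Summable fun k : ℕ => C * (1 / 2 : ℝ) ^ k := fun C =>
    summable_geometric_two.mul_left C
  refine ⟨fun z => ∑' k, MvPolynomial.eval z (P k), ?_, fun z => ?_⟩
  · exact differentiable_tsum_of_summable_bound (fun k => differentiable_eval (P k)) fun R =>
      ⟨_, hsummable _, fun k z hz => key R k z hz⟩
  · exact (Summable.of_norm_bounded (hsummable _) fun k => key ‖z‖ k z le_rfl).hasSum

/-! ### Homogeneous expansion of an entire function -/

/-- The coefficients of an everywhere convergent power series are determined by its sum. -/
theorem coeff_eq_of_forall_hasSum {a b : ℕ → ℂ} {s : ℂ → ℂ}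
    (ha : ∀ t : ℂ, HasSum (fun k => t ^ k * a k) (s t))
    (hb : ∀ t : ℂ, HasSum (fun k => t ^ k * b k) (s t)) : a = b := by
  have hser : ∀ c : ℕ → ℂ, (∀ t : ℂ, HasSum (fun k => t ^ k * c k) (s t)) →
      HasFPowerSeriesAt s (FormalMultilinearSeries.ofScalars ℂ c) 0 := by
    intro c hc
    refine hasFPowerSeriesAt_iff.mpr (Filter.Eventually.of_forall fun t => ?_)
    simpa [FormalMultilinearSeries.coeff_ofScalars] using hc t
  have h := (hser a ha).eq_formalMultilinearSeries (hser b hb)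
  funext k
  simpa [FormalMultilinearSeries.coeff_ofScalars] using
    congrArg (fun p : FormalMultilinearSeries ℂ ℂ ℂ => p.coeff k) h

/-- The homogeneous component of degree `k` of an entire function `F` at `z`: the Taylor
coefficient of order `k` of `t ↦ F (t z)`. -/
def taylorComponent {ι : Type} [Fintype ι] (F : (ι → ℂ) → ℂ) (k : ℕ) (z : ι → ℂ) : ℂ :=
  (k ! : ℂ)⁻¹ * iteratedDeriv k (fun t : ℂ => F (t • z)) 0

theorem hasSum_taylorComponent {ι : Type} [Fintype ι] {F : (ι → ℂ) → ℂ}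
    (hF : Differentiable ℂ F) (z : ι → ℂ) (t : ℂ) :
    HasSum (fun k => t ^ k * taylorComponent F k z) (F (t • z)) := by
  have hd : Differentiable ℂ fun t : ℂ => F (t • z) := by fun_prop
  refine (Complex.hasSum_taylorSeries_of_entire hd 0 t).congr_fun fun k => ?_
  rw [taylorComponent, sub_zero, smul_eq_mul, smul_eq_mul]
  ring

theorem taylorComponent_smul {ι : Type} [Fintype ι] {F : (ι → ℂ) → ℂ}
    (hF : Differentiable ℂ F) (k : ℕ) (s : ℂ) (z : ι → ℂ) :
    taylorComponent F k (s • z) = s ^ k * taylorComponent F k z := by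
  refine congrFun (coeff_eq_of_forall_hasSum (hasSum_taylorComponent hF (s • z))
    (b := fun k => s ^ k * taylorComponent F k z) fun t => ?_) k
  rw [smul_smul]
  refine (hasSum_taylorComponent hF z (t * s)).congr_fun fun k => ?_
  ring

theorem norm_taylorComponent_le {ι : Type} [Fintype ι] {F : (ι → ℂ) → ℂ}
    (hF : Differentiable ℂ F) {R M : ℝ} (hM : ∀ z, ‖z‖ ≤ R → ‖F z‖ ≤ M) (k : ℕ) {z : ι → ℂ}
    (hz : ‖z‖ ≤ R) : ‖taylorComponent F k z‖ ≤ M := by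
  have hd : Differentiable ℂ fun t : ℂ => F (t • z) := by fun_prop
  have h := Complex.norm_iteratedDeriv_le_of_forall_mem_sphere_norm_le (c := 0) (R := 1) (C := M)
    k one_pos hd.diffContOnCl fun t ht => hM _ (by
      rw [norm_smul, mem_sphere_zero_iff_norm.mp ht, one_mul]; exact hz)
  rw [taylorComponent, norm_mul, norm_inv, Complex.norm_natCast]
  rw [one_pow, div_one] at h
  rwa [inv_mul_le_iff₀ (by exact_mod_cast Nat.factorial_pos k)]

theorem exists_bound_of_continuous {ι : Type} [Fintype ι] {F : (ι → ℂ) → ℂ} (hF : Continuous F)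
    (R : ℝ) : ∃ M, ∀ z, ‖z‖ ≤ R → ‖F z‖ ≤ M := by
  obtain ⟨M, hM⟩ := (isCompact_closedBall (0 : ι → ℂ) R).exists_bound_of_continuousOn
    hF.continuousOn
  exact ⟨M, fun z hz => hM z (mem_closedBall_zero_iff.mpr hz)⟩

/-- The coefficient of order `k` of a power series is recovered, up to `O(s)`, from the sum of the
series at `s` and the previous coefficients. -/
theorem norm_divided_remainder_sub_le {a : ℕ → ℂ} {M : ℝ} (ha : ∀ k, ‖a k‖ ≤ M) {s S : ℂ}
    (hs0 : s ≠ 0) (hs : ‖s‖ ≤ 1 / 2) (h : HasSum (fun k => s ^ k * a k) S) (k : ℕ) :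
    ‖(S - ∑ j ∈ Finset.range k, s ^ j * a j) / s ^ k - a k‖ ≤ 2 * M * ‖s‖ := by
  have hM : 0 ≤ M := (norm_nonneg _).trans (ha 0)
  have h1 := (hasSum_nat_add_iff' (k + 1)).mpr h
  have hgeo := (hasSum_geometric_of_lt_one (norm_nonneg s) (by linarith)).mul_left
    (M * ‖s‖ ^ (k + 1))
  have h2 : ‖S - ∑ j ∈ Finset.range (k + 1), s ^ j * a j‖ ≤
      M * ‖s‖ ^ (k + 1) * (1 - ‖s‖)⁻¹ := by
    rw [← h1.tsum_eq]
    refine tsum_of_norm_bounded hgeo fun j => ?_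
    rw [norm_mul, norm_pow, pow_add]
    nlinarith [ha (j + (k + 1)), mul_nonneg (pow_nonneg (norm_nonneg s) j)
      (pow_nonneg (norm_nonneg s) (k + 1))]
  have h3 : (1 - ‖s‖)⁻¹ ≤ 2 := by
    rw [inv_le_comm₀ (by linarith) two_pos]
    linarith
  have h4 : (S - ∑ j ∈ Finset.range k, s ^ j * a j) / s ^ k - a k =
      (S - ∑ j ∈ Finset.range (k + 1), s ^ j * a j) / s ^ k := by
    rw [Finset.sum_range_succ]
    have := pow_ne_zero k hs0
    field_simp
    ring
  rw [h4, norm_div, norm_pow, div_le_iff₀ (pow_pos (norm_pos_iff.mpr hs0) k)]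
  calc _ ≤ M * ‖s‖ ^ (k + 1) * (1 - ‖s‖)⁻¹ := h2
    _ ≤ M * ‖s‖ ^ (k + 1) * 2 := by gcongr
    _ = _ := by ring

theorem norm_update_le {ι : Type} [Fintype ι] [DecidableEq ι] (z : ι → ℂ) (i : ι) (t : ℂ) :
    ‖Function.update z i t‖ ≤ ‖z‖ + ‖t‖ := by
  refine (pi_norm_le_iff_of_nonneg (by positivity)).mpr fun j => ?_
  by_cases h : j = i
  · subst h
    rw [Function.update_self]
    linarith [norm_nonneg z]
  · rw [Function.update_of_ne h]
    linarith [norm_le_pi_norm z j, norm_nonneg t]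

theorem differentiable_update {ι : Type} [Fintype ι] [DecidableEq ι] (z : ι → ℂ) (i : ι) :
    Differentiable ℂ fun t : ℂ => Function.update z i t := by
  rw [differentiable_pi]
  intro j
  by_cases h : j = i
  · subst h
    simp
  · simp [Function.update_of_ne h]

/-- The homogeneous components are holomorphic in each variable, as locally uniform limits. -/
theorem differentiable_taylorComponent_update {ι : Type} [Fintype ι] [DecidableEq ι]
    {F : (ι → ℂ) → ℂ} (hF : Differentiable ℂ F) (k : ℕ) (z : ι → ℂ) (i : ι) :
    Differentiable ℂ fun t : ℂ => taylorComponent F k (Function.update z i t) := by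
  induction k using Nat.strong_induction_on with
  | _ k ih =>
    -- a sequence of nonzero scalars of norm at most `1 / 2` tending to zero
    set s : ℕ → ℂ := fun m => (1 / 2 : ℂ) ^ (m + 1) with hs
    have hs0 : ∀ m, s m ≠ 0 := fun m => pow_ne_zero _ (by norm_num)
    have hsn : ∀ m, ‖s m‖ = (1 / 2 : ℝ) ^ (m + 1) := fun m => by simp [hs]
    have hs2 : ∀ m, ‖s m‖ ≤ 1 / 2 := fun m => by
      rw [hsn, pow_succ]
      have : (1 / 2 : ℝ) ^ m ≤ 1 := pow_le_one₀ (by norm_num) (by norm_num)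
      linarith
    have hlim : Filter.Tendsto (fun m => ‖s m‖) Filter.atTop (nhds 0) := by
      simp only [hsn]
      exact (tendsto_pow_atTop_nhds_zero_of_lt_one (by norm_num) (by norm_num)).comp
        (Filter.tendsto_add_atTop_nat 1)
    rw [← differentiableOn_univ]
    suffices hT : TendstoLocallyUniformlyOn (fun m t => (F (s m • Function.update z i t) -
        ∑ j ∈ Finset.range k, s m ^ j * taylorComponent F j (Function.update z i t)) / s m ^ k)
        (fun t => taylorComponent F k (Function.update z i t)) Filter.atTop Set.univ by
      refine hT.differentiableOn (Filter.Eventually.of_forall fun m =>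
        Differentiable.differentiableOn ?_) isOpen_univ
      have h1 := differentiable_update z i
      have h2 : Differentiable ℂ fun t => ∑ j ∈ Finset.range k,
          s m ^ j * taylorComponent F j (Function.update z i t) :=
        Differentiable.fun_sum fun j hj => (ih j (Finset.mem_range.mp hj)).const_mul _
      exact ((hF.comp (h1.const_smul (s m))).sub h2).div_const _
    rw [Metric.tendstoLocallyUniformlyOn_iff]
    intro ε hε t₀ _
    obtain ⟨M, hM⟩ := exists_bound_of_continuous hF.continuous (‖z‖ + (‖t₀‖ + 1))
    refine ⟨Metric.ball t₀ 1, mem_nhdsWithin_of_mem_nhds (Metric.ball_mem_nhds _ one_pos), ?_⟩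
    have hlim2 : Filter.Tendsto (fun m => 2 * M * ‖s m‖) Filter.atTop (nhds 0) := by
      simpa using hlim.const_mul (2 * M)
    filter_upwards [hlim2.eventually (gt_mem_nhds hε)] with m hm t ht
    rw [dist_comm, dist_eq_norm]
    refine lt_of_le_of_lt (norm_divided_remainder_sub_le (fun j => ?_) (hs0 m) (hs2 m)
      (hasSum_taylorComponent hF _ _) k) hm
    refine norm_taylorComponent_le hF hM j ((norm_update_le z i t).trans ?_)
    have : ‖t‖ ≤ ‖t - t₀‖ + ‖t₀‖ := by simpa using norm_add_le (t - t₀) t₀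
    rw [mem_ball_iff_norm] at ht
    linarith

theorem norm_taylorComponent_le_pow {ι : Type} [Fintype ι] {F : (ι → ℂ) → ℂ}
    (hF : Differentiable ℂ F) {M : ℝ} (hM : ∀ z, ‖z‖ ≤ 1 → ‖F z‖ ≤ M) (k : ℕ) (z : ι → ℂ) :
    ‖taylorComponent F k z‖ ≤ M * (1 + ‖z‖) ^ k := by
  have h1 : (0 : ℝ) < 1 + ‖z‖ := by positivity
  have h2 : ((1 + ‖z‖ : ℝ) : ℂ) ≠ 0 := Complex.ofReal_ne_zero.mpr h1.ne'
  have h3 : z = ((1 + ‖z‖ : ℝ) : ℂ) • (((1 + ‖z‖ : ℝ) : ℂ)⁻¹ • z) := by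
    rw [smul_smul, mul_inv_cancel₀ h2, one_smul]
  have h4 : ‖((1 + ‖z‖ : ℝ) : ℂ)⁻¹ • z‖ ≤ 1 := by
    rw [norm_smul, norm_inv, Complex.norm_real, Real.norm_of_nonneg h1.le,
      inv_mul_le_iff₀ h1]
    linarith
  conv_lhs => rw [h3, taylorComponent_smul hF]
  rw [norm_mul, norm_pow, Complex.norm_real, Real.norm_of_nonneg h1.le, mul_comm]
  exact mul_le_mul_of_nonneg_right (norm_taylorComponent_le hF hM k h4) (by positivity)

/-- An entire function of one variable of polynomial growth is a polynomial. -/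
theorem exists_polynomial_of_growth {g : ℂ → ℂ} (hg : Differentiable ℂ g) {C A : ℝ} {k : ℕ}
    (hC0 : 0 ≤ C) (hA : 0 ≤ A) (hC : ∀ t, ‖g t‖ ≤ C * (A + ‖t‖) ^ k) :
    ∃ p : Polynomial ℂ, p.degree < (k + 1 : ℕ) ∧ ∀ t, g t = p.eval t := by
  -- Cauchy's estimate on circles of radius `R → ∞`
  have hzero : ∀ m, k < m → iteratedDeriv m g 0 = 0 := by
    intro m hm
    rw [← norm_eq_zero]
    refine le_antisymm ?_ (norm_nonneg _)
    have hlim : Filter.Tendsto (fun R : ℝ => (m ! : ℝ) * (C * (A + 1) ^ k) * R⁻¹) Filter.atTop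
        (nhds 0) := by
      simpa using tendsto_inv_atTop_zero.const_mul ((m ! : ℝ) * (C * (A + 1) ^ k))
    refine ge_of_tendsto hlim ?_
    filter_upwards [Filter.eventually_ge_atTop 1] with R hR
    have hR0 : (0 : ℝ) < R := by linarith
    have h := Complex.norm_iteratedDeriv_le_of_forall_mem_sphere_norm_le (c := 0)
      (C := C * ((A + 1) * R) ^ k) m hR0 hg.diffContOnCl fun t ht => by
        refine (hC t).trans ?_
        rw [mem_sphere_zero_iff_norm.mp ht]
        gcongr
        nlinarith
    refine h.trans ?_
    rw [div_le_iff₀ (by positivity), mul_pow]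
    have h1 : R ^ k ≤ R⁻¹ * R ^ m := by
      rw [inv_mul_eq_div, le_div_iff₀ hR0, ← pow_succ]
      exact pow_le_pow_right₀ hR hm
    calc (m ! : ℝ) * (C * ((A + 1) ^ k * R ^ k)) = m ! * (C * (A + 1) ^ k) * R ^ k := by ring
      _ ≤ m ! * (C * (A + 1) ^ k) * (R⁻¹ * R ^ m) := by gcongr
      _ = _ := by ring
  refine ⟨∑ j ∈ Finset.range (k + 1),
    Polynomial.C ((j ! : ℂ)⁻¹ * iteratedDeriv j g 0) * Polynomial.X ^ j, ?_, fun t => ?_⟩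
  · refine (Polynomial.degree_sum_le _ _).trans_lt
      ((Finset.sup_lt_iff (WithBot.bot_lt_coe _)).mpr fun j hj => ?_)
    exact (Polynomial.degree_C_mul_X_pow_le j _).trans_lt
      (by exact_mod_cast Finset.mem_range.mp hj)
  · have h := Complex.hasSum_taylorSeries_of_entire hg 0 t
    have h2 : HasSum (fun n : ℕ => (n ! : ℂ)⁻¹ • (t - 0) ^ n • iteratedDeriv n g 0)
        (∑ n ∈ Finset.range (k + 1), (n ! : ℂ)⁻¹ • (t - 0) ^ n • iteratedDeriv n g 0) :=
      hasSum_sum_of_ne_finset_zero fun m hm => by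
        rw [hzero m (by simpa using hm)]
        simp
    rw [h.unique h2, Polynomial.eval_finsetSum]
    refine Finset.sum_congr rfl fun j _ => ?_
    simp
    ring

/-- A function which is a polynomial of degree at most `k` in each variable is a polynomial, by
Lagrange interpolation in one variable after the other. -/
theorem exists_mvPolynomial_of_separately {ι : Type} [Fintype ι] [DecidableEq ι] (k : ℕ)
    (q : (ι → ℂ) → ℂ)
    (hq : ∀ z i, ∃ p : Polynomial ℂ, p.degree < (k + 1 : ℕ) ∧
      ∀ t, q (Function.update z i t) = p.eval t) :
    ∃ P : MvPolynomial ι ℂ, ∀ z, q z = MvPolynomial.eval z P := by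
  suffices H : ∀ (S : Finset ι) (q : (ι → ℂ) → ℂ),
      (∀ z i, ∃ p : Polynomial ℂ, p.degree < (k + 1 : ℕ) ∧
        ∀ t, q (Function.update z i t) = p.eval t) →
      (∀ z w, (∀ i ∈ S, z i = w i) → q z = q w) →
      ∃ P : MvPolynomial ι ℂ, ∀ z, q z = MvPolynomial.eval z P from
    H Finset.univ q hq fun z w h => congrArg q (funext fun i => h i (Finset.mem_univ i))
  intro S
  induction S using Finset.induction_on with
  | empty =>
    intro q _ h
    exact ⟨MvPolynomial.C (q 0), fun z => by
      rw [MvPolynomial.eval_C]; exact h z 0 fun i hi => absurd hi (Finset.notMem_empty i)⟩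
  | insert i S hi ih =>
    intro q hq hdep
    have hnodes : Set.InjOn (fun j : ℕ => (j : ℂ)) (Finset.range (k + 1)) :=
      Nat.cast_injective.injOn
    -- interpolate in the variable `i` at the nodes `0, …, k`
    have hslice : ∀ j : ℕ, ∃ P : MvPolynomial ι ℂ,
        ∀ z, q (Function.update z i j) = MvPolynomial.eval z P := by
      intro j
      refine ih (fun z => q (Function.update z i j)) (fun z i' => ?_) fun z w h => ?_
      · by_cases hii : i' = i
        · subst hii
          refine ⟨Polynomial.C (q (Function.update z i' j)),
            Polynomial.degree_C_le.trans_lt (by exact_mod_cast Nat.succ_pos k), fun t => ?_⟩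
          rw [Function.update_idem, Polynomial.eval_C]
        · obtain ⟨p, hp, hpe⟩ := hq (Function.update z i j) i'
          exact ⟨p, hp, fun t => by rw [Function.update_comm hii, hpe]⟩
      · refine hdep _ _ fun i' hi' => ?_
        by_cases hii : i' = i
        · subst hii; simp
        · rw [Function.update_of_ne hii, Function.update_of_ne hii]
          exact h i' ((Finset.mem_insert.mp hi').resolve_left hii)
    choose P hP using hslice
    refine ⟨∑ j ∈ Finset.range (k + 1), P j * Polynomial.aeval (MvPolynomial.X i)
      (Lagrange.basis (Finset.range (k + 1)) (fun j : ℕ => (j : ℂ)) j), fun z => ?_⟩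
    obtain ⟨p, hp, hpe⟩ := hq z i
    have h1 := Lagrange.eq_interpolate hnodes (f := p) (by rwa [Finset.card_range])
    have h2 : q z = p.eval (z i) := by rw [← hpe, Function.update_eq_self]
    rw [h2, h1, Lagrange.interpolate_apply, Polynomial.eval_finsetSum, map_sum]
    refine Finset.sum_congr rfl fun j _ => ?_
    rw [map_mul, ← hP, ← hpe, Polynomial.eval_mul, Polynomial.eval_C]
    congr 1
    have h3 := Polynomial.aeval_algHom_apply (MvPolynomial.aeval (R := ℂ) z)
      (MvPolynomial.X i : MvPolynomial ι ℂ)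
      (Lagrange.basis (Finset.range (k + 1)) (fun j : ℕ => (j : ℂ)) j)
    rw [MvPolynomial.aeval_X] at h3
    exact h3

theorem hasSum_eval_homogeneousComponent {ι : Type} [Fintype ι] (P : MvPolynomial ι ℂ)
    (t : ℂ) (z : ι → ℂ) :
    HasSum (fun k => t ^ k * MvPolynomial.eval z (MvPolynomial.homogeneousComponent k P))
      (MvPolynomial.eval (t • z) P) := by
  have h : HasSum (fun k => t ^ k * MvPolynomial.eval z (MvPolynomial.homogeneousComponent k P))
      (∑ k ∈ Finset.range (P.totalDegree + 1),
        t ^ k * MvPolynomial.eval z (MvPolynomial.homogeneousComponent k P)) :=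
    hasSum_sum_of_ne_finset_zero fun k hk => by
      rw [MvPolynomial.homogeneousComponent_eq_zero _ _ (by simpa using hk), map_zero, mul_zero]
  convert h
  conv_lhs => rw [← MvPolynomial.sum_homogeneousComponent P, map_sum]
  exact Finset.sum_congr rfl fun k _ =>
    eval_smul_of_isHomogeneous (MvPolynomial.homogeneousComponent_isHomogeneous k P) t z

/-- Every entire function is the sum of a series of homogeneous polynomials. -/
theorem exists_homogeneous_expansion {ι : Type} [Fintype ι] {F : (ι → ℂ) → ℂ}
    (hF : Differentiable ℂ F) :
    ∃ P : ℕ → MvPolynomial ι ℂ, (∀ k, (P k).IsHomogeneous k) ∧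
      ∀ z, HasSum (fun k => MvPolynomial.eval z (P k)) (F z) := by
  classical
  have hpoly : ∀ k, ∃ P : MvPolynomial ι ℂ, P.IsHomogeneous k ∧
      ∀ z, taylorComponent F k z = MvPolynomial.eval z P := by
    intro k
    obtain ⟨M, hM⟩ := exists_bound_of_continuous hF.continuous 1
    have hM0 : 0 ≤ M := (norm_nonneg _).trans (hM 0 (by simp))
    obtain ⟨P, hP⟩ := exists_mvPolynomial_of_separately k (taylorComponent F k) fun z i =>
      exists_polynomial_of_growth (differentiable_taylorComponent_update hF k z i) hM0
        (A := 1 + ‖z‖) (by positivity) fun t =>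
          (norm_taylorComponent_le_pow hF hM k _).trans (mul_le_mul_of_nonneg_left
            (pow_le_pow_left₀ (by positivity) (by linarith [norm_update_le z i t]) k) hM0)
    refine ⟨MvPolynomial.homogeneousComponent k P,
      MvPolynomial.homogeneousComponent_isHomogeneous k P, fun z => ?_⟩
    -- compare the coefficients of `t ^ k` in `P (t z) = t ^ k P(z)`
    have h1 := coeff_eq_of_forall_hasSum
      (fun t => hasSum_eval_homogeneousComponent P t z)
      (b := fun j => if j = k then taylorComponent F k z else 0) fun t => by
        rw [← hP, taylorComponent_smul hF]
        refine (hasSum_ite_eq k (t ^ k * taylorComponent F k z)).congr_fun fun j => ?_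
        split_ifs with h
        · rw [h]
        · rw [mul_zero]
    have h2 := congrFun h1 k
    simp only [if_pos] at h2
    exact h2.symm
  choose P hP hPe using hpoly
  refine ⟨P, hP, fun z => ?_⟩
  have h := hasSum_taylorComponent hF z 1
  simpa only [one_pow, one_mul, one_smul, hPe] using h

/-- A linear symmetry of a function is a symmetry of its homogeneous components. -/
theorem eval_eq_of_hasSum_homogeneous {ι : Type} [Fintype ι] {F : (ι → ℂ) → ℂ}
    {P : ℕ → MvPolynomial ι ℂ} (hP : ∀ k, (P k).IsHomogeneous k)
    (hsum : ∀ z, HasSum (fun k => MvPolynomial.eval z (P k)) (F z))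
    {L : (ι → ℂ) → (ι → ℂ)} (hL : ∀ (t : ℂ) z, L (t • z) = t • L z) {c : ℂ}
    (h : ∀ z, F z = c * F (L z)) (k : ℕ) (z : ι → ℂ) :
    MvPolynomial.eval z (P k) = c * MvPolynomial.eval (L z) (P k) := by
  refine congrFun (coeff_eq_of_forall_hasSum (s := fun t => F (t • z))
    (a := fun k => MvPolynomial.eval z (P k))
    (b := fun k => c * MvPolynomial.eval (L z) (P k)) (fun t => ?_) fun t => ?_) k
  · exact (hsum (t • z)).congr_fun fun k => (eval_smul_of_isHomogeneous (hP k) t z).symm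
  · rw [h, hL]
    refine ((hsum (t • L z)).mul_left c).congr_fun fun k => ?_
    rw [eval_smul_of_isHomogeneous (hP k)]
    ring

/-! ### The canonical map on polynomials -/

theorem restrictDiag_mul {n : ℕ} (F G : MvPolynomial (Fin n × Fin n) ℂ) :
    restrictDiag (F * G) = restrictDiag F * restrictDiag G :=
  map_mul (MvPolynomial.aeval _) F G

theorem restrictDiag_add {n : ℕ} (F G : MvPolynomial (Fin n × Fin n) ℂ) :
    restrictDiag (F + G) = restrictDiag F + restrictDiag G :=
  map_add (MvPolynomial.aeval _) F G

theorem restrictDiag_C {n : ℕ} (a : ℂ) :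
    restrictDiag (MvPolynomial.C a : MvPolynomial (Fin n × Fin n) ℂ) = MvPolynomial.C a :=
  (MvPolynomial.aeval _).commutes a

/-- The canonical map `F ↦ c Δ F|_D` on polynomials. -/
def psiPoly {n : ℕ} (F : MvPolynomial (Fin n × Fin n) ℂ) : MvPolynomial (Fin n) ℂ :=
  MvPolynomial.C (hcConst n : ℂ) * (vandermondePoly n * restrictDiag F)

theorem psi_eval_apply {n : ℕ} (F : MvPolynomial (Fin n × Fin n) ℂ) (x : Fin n → ℂ) :
    psi n (fun z => MvPolynomial.eval z F) x = MvPolynomial.eval x (psiPoly F) := by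
  rw [psiPoly, map_mul, map_mul, MvPolynomial.eval_C, eval_vandermondePoly, eval_restrictDiag,
    ← mul_assoc]
  rfl

theorem prod_factorial_pos (n : ℕ) : (0 : ℝ) < ∏ p ∈ Finset.Icc 1 n, (p ! : ℝ) :=
  Finset.prod_pos fun p _ => by exact_mod_cast Nat.factorial_pos p

theorem hcConst_ne_zero (n : ℕ) : (hcConst n : ℂ) ≠ 0 :=
  Complex.ofReal_ne_zero.mpr (inv_ne_zero (Real.sqrt_pos.mpr (prod_factorial_pos n)).ne')

/-- The constant `c` normalises the Vandermonde product. -/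
theorem hcConst_sq_mul_fischer_vandermondePoly (n : ℕ) :
    (hcConst n : ℂ) ^ 2 * fischer (vandermondePoly n) (vandermondePoly n) = 1 := by
  rw [fischer_vandermondePoly, ← Complex.ofReal_pow, ← Complex.ofReal_mul, hcConst, inv_pow,
    Real.sq_sqrt (prod_factorial_pos n).le, inv_mul_cancel₀ (prod_factorial_pos n).ne',
    Complex.ofReal_one]

theorem fischer_psiPoly {n : ℕ} (F G : MvPolynomial (Fin n × Fin n) ℂ) :
    fischer (psiPoly F) (psiPoly G) = (hcConst n : ℂ) ^ 2 *
      fischer (vandermondePoly n * restrictDiag F) (vandermondePoly n * restrictDiag G) := by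
  rw [psiPoly, psiPoly, fischer_C_mul_left, fischer_C_mul_right, Complex.conj_ofReal]
  ring

/-! ### From unitarity to the differential operator identity -/

theorem rename_vandermondePoly_mul {n : ℕ} {Q : MvPolynomial (Fin n) ℂ} (hQ : Q.IsSymmetric)
    (σ : Equiv.Perm (Fin n)) :
    MvPolynomial.rename σ (vandermondePoly n * Q) =
      ((Equiv.Perm.sign σ : ℤ) : MvPolynomial (Fin n) ℂ) * (vandermondePoly n * Q) := by
  rw [map_mul, rename_vandermondePoly, hQ σ, mul_assoc]

theorem rename_diffOp_of_isSymmetric {n : ℕ} {Q P : MvPolynomial (Fin n) ℂ} (hQ : Q.IsSymmetric)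
    (hP : ∀ σ : Equiv.Perm (Fin n), MvPolynomial.rename σ P =
      ((Equiv.Perm.sign σ : ℤ) : MvPolynomial (Fin n) ℂ) * P) (σ : Equiv.Perm (Fin n)) :
    MvPolynomial.rename σ (diffOp Q P) =
      ((Equiv.Perm.sign σ : ℤ) : MvPolynomial (Fin n) ℂ) * diffOp Q P := by
  have h := diffOp_rename σ Q P
  rw [hQ σ⁻¹, hP σ, ← zsmul_eq_mul, map_zsmul, zsmul_eq_mul] at h
  exact h.symm

/-- The canonical map preserves inner products of invariant polynomials. -/
def IsPsiIsometric (n : ℕ) : Prop :=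
  ∀ A B : MvPolynomial (Fin n × Fin n) ℂ, (IsConjInvariant fun z => MvPolynomial.eval z A) →
    (IsConjInvariant fun z => MvPolynomial.eval z B) →
    fischer (psiPoly A) (psiPoly B) = fischer A B

/-- If the canonical map preserves inner products of invariant polynomials, then the two sides of
the differential operator identity agree: their difference is alternating, hence in the image of
the canonical map, and by adjointness it is orthogonal to that image. -/
theorem diffOp_identity_of_isometry {n : ℕ} (h : IsPsiIsometric n)
    {F G : MvPolynomial (Fin n × Fin n) ℂ} (hF : IsConjInvariant fun z => MvPolynomial.eval z F)
    (hG : IsConjInvariant fun z => MvPolynomial.eval z G) :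
    vandermondePoly n * restrictDiag (diffOp F G) =
      diffOp (restrictDiag F) (vandermondePoly n * restrictDiag G) := by
  have hK := isConjInvariant_diffOp hF hG
  rw [← sub_eq_zero]
  obtain ⟨B, hB, hD⟩ := exists_invariant_of_alternating
    (vandermondePoly n * restrictDiag (diffOp F G) -
      diffOp (restrictDiag F) (vandermondePoly n * restrictDiag G)) fun σ => by
    rw [map_sub, rename_vandermondePoly_mul (isSymmetric_restrictDiag hK),
      rename_diffOp_of_isSymmetric (isSymmetric_restrictDiag hF)
        (rename_vandermondePoly_mul (isSymmetric_restrictDiag hG)), mul_sub]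
  refine eq_zero_of_fischer_self ?_
  nth_rewrite 1 [hD]
  rw [fischer_sub_right]
  have hc2 : (hcConst n : ℂ) ^ 2 ≠ 0 := pow_ne_zero 2 (hcConst_ne_zero n)
  refine mul_left_cancel₀ hc2 ?_
  have hFB : IsConjInvariant fun z => MvPolynomial.eval z (conjPoly F * B) := fun u z => by
    simp only [map_mul]
    exact congrArg₂ (· * ·) (isConjInvariant_conjPoly hF u z) (hB u z)
  have h1 : (hcConst n : ℂ) ^ 2 * fischer (vandermondePoly n * restrictDiag B)
      (vandermondePoly n * restrictDiag (diffOp F G)) = fischer (conjPoly F * B) G := by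
    rw [← fischer_psiPoly, h B _ hB hK, fischer_mul_left, conjPoly_conjPoly]
  have h2 : (hcConst n : ℂ) ^ 2 * fischer (vandermondePoly n * restrictDiag B)
      (diffOp (restrictDiag F) (vandermondePoly n * restrictDiag G)) =
        fischer (conjPoly F * B) G := by
    rw [← h _ _ hFB hG, fischer_psiPoly, restrictDiag_mul, restrictDiag_conjPoly, mul_left_comm,
      fischer_mul_left (conjPoly _), conjPoly_conjPoly]
  rw [mul_sub, h1, h2, sub_self, mul_zero]

/-! ### From the differential operator identity to unitarity -/

/-- The differential operator identity makes the canonical map isometric on polynomials: with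
`K = F*(∂) G`, one has `⟨Δ F|_D, Δ G|_D⟩ = ⟨Δ, Δ K|_D⟩ = ‖Δ‖² K(0) = ‖Δ‖² ⟨F, G⟩`. -/
theorem isometry_of_diffOp_identity {n : ℕ}
    (h : ∀ A B : MvPolynomial (Fin n × Fin n) ℂ, (IsConjInvariant fun z => MvPolynomial.eval z A) →
      (IsConjInvariant fun z => MvPolynomial.eval z B) →
      vandermondePoly n * restrictDiag (diffOp A B) =
        diffOp (restrictDiag A) (vandermondePoly n * restrictDiag B)) :
    IsPsiIsometric n := by
  intro F G hF hG
  rw [fischer_psiPoly, mul_comm (vandermondePoly n) (restrictDiag F), fischer_mul_left,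
    ← restrictDiag_conjPoly, ← h _ _ (isConjInvariant_conjPoly hF) hG,
    fischer_mul_right_of_isHomogeneous (isHomogeneous_vandermondePoly n),
    constantCoeff_restrictDiag, constantCoeff_diffOp, ← mul_assoc,
    hcConst_sq_mul_fischer_vandermondePoly, one_mul]

/-- The squared norm of the Segal-Bargmann space, with the normalisation of `sbInner`. -/
def sbNormSq {ι : Type} [Fintype ι] (F : (ι → ℂ) → ℂ) : ENNReal :=
  (ENNReal.ofReal (Real.pi ^ Fintype.card ι))⁻¹ * gaussNormSq F

theorem ofReal_pi_pow_ne_zero (N : ℕ) : ENNReal.ofReal (Real.pi ^ N) ≠ 0 :=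
  (ENNReal.ofReal_pos.mpr (pow_pos Real.pi_pos N)).ne'

theorem mem_segalBargmann_iff_sbNormSq {ι : Type} [Fintype ι] (F : (ι → ℂ) → ℂ) :
    F ∈ segalBargmann ι ↔ Differentiable ℂ F ∧ sbNormSq F ≠ ⊤ := by
  rw [mem_segalBargmann_iff_gaussNormSq, sbNormSq]
  refine and_congr_right fun _ => ?_
  simp [ENNReal.mul_eq_top, (pow_pos Real.pi_pos _ : 0 < Real.pi ^ Fintype.card ι)]

theorem sbNormSq_eq_tsum {ι : Type} [Fintype ι] {d : ℕ} {P : ℕ → MvPolynomial ι ℂ}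
    (hP : ∀ k, (P k).IsHomogeneous (d + k)) {F : (ι → ℂ) → ℂ} (hF : Continuous F)
    (hsum : ∀ z, HasSum (fun k => MvPolynomial.eval z (P k)) (F z)) :
    sbNormSq F = ∑' k, ENNReal.ofReal (fischerNormSq (P k)) := by
  rw [sbNormSq, gaussNormSq_eq_tsum hP hF hsum, ← ENNReal.tsum_mul_left]
  refine tsum_congr fun k => ?_
  rw [gaussNormSq_eval, ENNReal.ofReal_mul (pow_pos Real.pi_pos _).le, ← mul_assoc,
    ENNReal.inv_mul_cancel (ofReal_pi_pow_ne_zero _) ENNReal.ofReal_ne_top, one_mul]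

/-- The inner product is determined by the norm, by polarisation in `L²`. -/
theorem sbInner_eq_polarization {ι : Type} [Fintype ι] {F G : (ι → ℂ) → ℂ}
    (hF : F ∈ segalBargmann ι) (hG : G ∈ segalBargmann ι) :
    sbInner F G = (((sbNormSq (F + G)).toReal : ℂ) - ((sbNormSq (F - G)).toReal : ℂ) +
      (((sbNormSq (F - Complex.I • G)).toReal : ℂ) -
        ((sbNormSq (F + Complex.I • G)).toReal : ℂ)) * Complex.I) / 4 := by
  have hF2 := ((mem_segalBargmann_iff F).mp hF).2
  have hG2 := ((mem_segalBargmann_iff G).mp hG).2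
  have hnorm : ∀ {H : (ι → ℂ) → ℂ} (hH : MemLp H 2 (gaussianMeas ι)),
      (‖hH.toLp H‖ : ℂ) ^ 2 = (Real.pi : ℂ) ^ Fintype.card ι * ((sbNormSq H).toReal : ℂ) := by
    intro H hH
    rw [Lp.norm_toLp, ← Complex.ofReal_pow, ← ENNReal.toReal_pow, eLpNorm_sq_eq_gaussNormSq,
      sbNormSq, ENNReal.toReal_mul, ENNReal.toReal_inv,
      ENNReal.toReal_ofReal (pow_pos Real.pi_pos _).le]
    have : (Real.pi : ℂ) ≠ 0 := Complex.ofReal_ne_zero.mpr Real.pi_ne_zero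
    push_cast
    field_simp
  have hinner : sbInner F G = ((Real.pi : ℂ) ^ Fintype.card ι)⁻¹ *
      inner ℂ (hF2.toLp F) (hG2.toLp G) := by
    rw [sbInner_eq_integral_gaussianMeas, L2.inner_def]
    congr 1
    refine integral_congr_ae ?_
    filter_upwards [hF2.coeFn_toLp, hG2.coeFn_toLp] with z h1 h2
    rw [h1, h2, RCLike.inner_apply, mul_comm]
  rw [hinner, inner_eq_sum_norm_sq_div_four]
  have hI : (RCLike.I : ℂ) = Complex.I := rfl
  simp only [hI, ← MemLp.toLp_const_smul, ← MemLp.toLp_add, ← MemLp.toLp_sub]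
  have e : ∀ r : ℝ, (RCLike.ofReal r : ℂ) = (r : ℂ) := fun _ => rfl
  simp only [e, hnorm]
  have : (Real.pi : ℂ) ≠ 0 := Complex.ofReal_ne_zero.mpr Real.pi_ne_zero
  field_simp

theorem isHomogeneous_psiPoly {n k : ℕ} {F : MvPolynomial (Fin n × Fin n) ℂ}
    (hF : F.IsHomogeneous k) :
    (psiPoly F).IsHomogeneous ((∑ i : Fin n, (Finset.Ioi i).card) + k) :=
  ((isHomogeneous_vandermondePoly n).mul (isHomogeneous_restrictDiag hF)).C_mul _

/-- The canonical map raises degrees by the degree of the Vandermonde product. -/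
theorem homogeneousComponent_psiPoly {n : ℕ} (k : ℕ) (F : MvPolynomial (Fin n × Fin n) ℂ) :
    MvPolynomial.homogeneousComponent ((∑ i : Fin n, (Finset.Ioi i).card) + k) (psiPoly F) =
      psiPoly (MvPolynomial.homogeneousComponent k F) := by
  classical
  have hadd : ∀ A B : MvPolynomial (Fin n × Fin n) ℂ,
      psiPoly (A + B) = psiPoly A + psiPoly B := fun A B => by
    rw [psiPoly, restrictDiag_add, mul_add, mul_add]
    rfl
  induction F using MvPolynomial.induction_on' with
  | add p q hp hq => rw [hadd, map_add, hp, hq, map_add, hadd]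
  | monomial μ a =>
    have hμ := MvPolynomial.isHomogeneous_monomial a (rfl : μ.degree = μ.degree)
    rw [MvPolynomial.homogeneousComponent_of_mem
        ((MvPolynomial.mem_homogeneousSubmodule _ _).mpr (isHomogeneous_psiPoly hμ)),
      MvPolynomial.homogeneousComponent_of_mem
        ((MvPolynomial.mem_homogeneousSubmodule _ _).mpr hμ)]
    have hz : psiPoly (0 : MvPolynomial (Fin n × Fin n) ℂ) = 0 := by
      rw [psiPoly, ← MvPolynomial.C_0, restrictDiag_C, MvPolynomial.C_0, mul_zero, mul_zero]
    by_cases h : k = μ.degree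
    · simp [h]
    · simp [h, hz]

theorem differentiable_psi {n : ℕ} {F : (Fin n × Fin n → ℂ) → ℂ} (hF : Differentiable ℂ F) :
    Differentiable ℂ (psi n F) := by
  have h1 : Differentiable ℂ fun x : Fin n → ℂ => entries (Matrix.diagonal x) := by
    rw [differentiable_pi]
    intro p
    by_cases h : p.1 = p.2
    · simp only [entries, h, Matrix.diagonal_apply_eq]
      fun_prop
    · simp [entries, Matrix.diagonal_apply_ne _ h]
  have h2 : Differentiable ℂ fun x : Fin n → ℂ => vandermondeProd x := by
    have := differentiable_eval (vandermondePoly n)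
    simpa only [eval_vandermondePoly] using this
  exact (h2.const_mul (hcConst n : ℂ)).mul (hF.comp h1)

theorem hasSum_psi {n : ℕ} {F : (Fin n × Fin n → ℂ) → ℂ}
    {P : ℕ → MvPolynomial (Fin n × Fin n) ℂ}
    (hsum : ∀ z, HasSum (fun k => MvPolynomial.eval z (P k)) (F z)) (x : Fin n → ℂ) :
    HasSum (fun k => MvPolynomial.eval x (psiPoly (P k))) (psi n F x) :=
  ((hsum _).mul_left ((hcConst n : ℂ) * vandermondeProd x)).congr_fun fun k =>
    (psi_eval_apply (P k) x).symm

theorem psi_alternating {n : ℕ} {F : (Fin n × Fin n → ℂ) → ℂ} (hF : IsConjInvariant F)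
    (σ : Equiv.Perm (Fin n)) (x : Fin n → ℂ) :
    psi n F x = ((Equiv.Perm.sign σ : ℤ) : ℂ) * psi n F fun i => x (σ⁻¹ i) := by
  have h1 := vandermondeProd_comp_perm x σ⁻¹
  have h2 := hF.diagonal_comp σ⁻¹ x
  have hs : ((Equiv.Perm.sign σ : ℤ) : ℂ) * ((Equiv.Perm.sign σ : ℤ) : ℂ) = 1 := by
    rcases Int.units_eq_one_or (Equiv.Perm.sign σ) with h | h <;> simp [h]
  change (hcConst n : ℂ) * vandermondeProd x * F (entries (Matrix.diagonal x)) =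
    _ * ((hcConst n : ℂ) * vandermondeProd (x ∘ ⇑σ⁻¹) * F (entries (Matrix.diagonal (x ∘ ⇑σ⁻¹))))
  rw [h1, h2, Equiv.Perm.sign_inv]
  linear_combination (-(hcConst n : ℂ) * vandermondeProd x * F (entries (Matrix.diagonal x))) * hs

theorem mem_invariantSB_iff {n : ℕ} (F : (Fin n × Fin n → ℂ) → ℂ) :
    F ∈ invariantSB n ↔ F ∈ segalBargmann (Fin n × Fin n) ∧ IsConjInvariant F := by
  rw [isConjInvariant_iff]
  rfl

/-- An invariant entire function is a sum of invariant homogeneous polynomials. -/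
theorem exists_invariant_expansion {n : ℕ} {F : (Fin n × Fin n → ℂ) → ℂ}
    (hF : Differentiable ℂ F) (hFi : IsConjInvariant F) :
    ∃ P : ℕ → MvPolynomial (Fin n × Fin n) ℂ, (∀ k, (P k).IsHomogeneous k) ∧
      (∀ k, IsConjInvariant fun z => MvPolynomial.eval z (P k)) ∧
      ∀ z, HasSum (fun k => MvPolynomial.eval z (P k)) (F z) := by
  obtain ⟨P, hP, hsum⟩ := exists_homogeneous_expansion hF
  refine ⟨P, hP, fun k u z => ?_, hsum⟩
  have := eval_eq_of_hasSum_homogeneous hP hsum (L := (conjMatrix u).mulVec)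
    (fun t z => Matrix.mulVec_smul _ t z) (c := 1) (fun z => by rw [one_mul]; exact hFi u z) k z
  rwa [one_mul] at this

theorem isConjInvariant_homogeneousComponent {n : ℕ} {B : MvPolynomial (Fin n × Fin n) ℂ}
    (hB : IsConjInvariant fun z => MvPolynomial.eval z B) (k : ℕ) :
    IsConjInvariant fun z => MvPolynomial.eval z (MvPolynomial.homogeneousComponent k B) := by
  intro u z
  have := eval_eq_of_hasSum_homogeneous
    (fun k => MvPolynomial.homogeneousComponent_isHomogeneous k B)
    (F := fun z => MvPolynomial.eval z B) (fun z => by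
      simpa using hasSum_eval_homogeneousComponent B 1 z) (L := (conjMatrix u).mulVec)
    (fun t z => Matrix.mulVec_smul _ t z) (c := 1) (fun z => by rw [one_mul]; exact hB u z) k z
  rwa [one_mul] at this

theorem IsPsiIsometric.fischerNormSq_psiPoly {n : ℕ} (hiso : IsPsiIsometric n)
    {A : MvPolynomial (Fin n × Fin n) ℂ} (hA : IsConjInvariant fun z => MvPolynomial.eval z A) :
    fischerNormSq (psiPoly A) = fischerNormSq A := by
  have h := hiso A A hA hA
  rw [fischer_self, fischer_self] at h
  exact_mod_cast h

/-- Isometry on polynomials extends to entire functions, with both norms possibly infinite. -/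
theorem IsPsiIsometric.sbNormSq_psi {n : ℕ} (hiso : IsPsiIsometric n)
    {F : (Fin n × Fin n → ℂ) → ℂ} (hF : Differentiable ℂ F) (hFi : IsConjInvariant F) :
    sbNormSq (psi n F) = sbNormSq F := by
  obtain ⟨P, hP, hPi, hsum⟩ := exists_invariant_expansion hF hFi
  rw [sbNormSq_eq_tsum (d := 0) (fun k => by rw [zero_add]; exact hP k) hF.continuous hsum,
    sbNormSq_eq_tsum (fun k => isHomogeneous_psiPoly (hP k)) (differentiable_psi hF).continuous
      (hasSum_psi hsum)]
  exact tsum_congr fun k => by rw [hiso.fischerNormSq_psiPoly (hPi k)]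

theorem IsPsiIsometric.eq_zero_of_psi_eq_zero {n : ℕ} (hiso : IsPsiIsometric n)
    {F : (Fin n × Fin n → ℂ) → ℂ} (hF : Differentiable ℂ F) (hFi : IsConjInvariant F)
    (h0 : psi n F = 0) : F = 0 := by
  obtain ⟨P, hP, hPi, hsum⟩ := exists_invariant_expansion hF hFi
  have h := hiso.sbNormSq_psi hF hFi
  rw [h0, sbNormSq_eq_tsum (d := 0) (fun k => by rw [zero_add]; exact hP k) hF.continuous hsum] at h
  have hz : sbNormSq (0 : (Fin n → ℂ) → ℂ) = 0 := by
    simp [sbNormSq, gaussNormSq]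
  rw [hz, eq_comm, ENNReal.tsum_eq_zero] at h
  funext z
  refine (hsum z).unique (HasSum.congr_fun (f := fun _ : ℕ => (0 : ℂ)) hasSum_zero fun k => ?_)
  have hk : P k = 0 := eq_zero_of_fischer_self (by
    rw [fischer_self, le_antisymm (ENNReal.ofReal_eq_zero.mp (h k)) (fischerNormSq_nonneg _),
      Complex.ofReal_zero])
  rw [hk, map_zero]

theorem IsPsiIsometric.mapsTo_psi {n : ℕ} (hiso : IsPsiIsometric n)
    {F : (Fin n × Fin n → ℂ) → ℂ} (hF : F ∈ invariantSB n) : psi n F ∈ alternatingSB n := by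
  obtain ⟨hFs, hFi⟩ := (mem_invariantSB_iff F).mp hF
  obtain ⟨hFd, hFn⟩ := (mem_segalBargmann_iff_sbNormSq F).mp hFs
  refine ⟨(mem_segalBargmann_iff_sbNormSq _).mpr ⟨differentiable_psi hFd, ?_⟩,
    psi_alternating hFi⟩
  rwa [hiso.sbNormSq_psi hFd hFi]

theorem IsPsiIsometric.sbInner_psi {n : ℕ} (hiso : IsPsiIsometric n)
    {F G : (Fin n × Fin n → ℂ) → ℂ} (hF : F ∈ invariantSB n) (hG : G ∈ invariantSB n) :
    sbInner (psi n F) (psi n G) = sbInner F G := by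
  have key : ∀ {H}, H ∈ invariantSB n → sbNormSq (psi n H) = sbNormSq H := fun {H} hH =>
    hiso.sbNormSq_psi hH.1.1 ((mem_invariantSB_iff H).mp hH).2
  have hIG := Submodule.smul_mem _ Complex.I hG
  rw [sbInner_eq_polarization (hiso.mapsTo_psi hF).1 (hiso.mapsTo_psi hG).1,
    sbInner_eq_polarization hF.1 hG.1, ← map_smul, ← map_add, ← map_sub, ← map_add, ← map_sub,
    key (Submodule.add_mem _ hF hG), key (Submodule.sub_mem _ hF hG),
    key (Submodule.add_mem _ hF hIG), key (Submodule.sub_mem _ hF hIG)]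

/-- Every homogeneous alternating polynomial is the image of an invariant homogeneous polynomial,
of degree lower by the degree of the Vandermonde product. -/
theorem exists_psiPoly_eq_of_alternating {n : ℕ} {k : ℕ} {P : MvPolynomial (Fin n) ℂ}
    (hP : P.IsHomogeneous ((∑ i : Fin n, (Finset.Ioi i).card) + k))
    (halt : ∀ σ : Equiv.Perm (Fin n), MvPolynomial.rename σ P =
      ((Equiv.Perm.sign σ : ℤ) : MvPolynomial (Fin n) ℂ) * P) :
    ∃ B : MvPolynomial (Fin n × Fin n) ℂ, B.IsHomogeneous k ∧
      (IsConjInvariant fun z => MvPolynomial.eval z B) ∧ psiPoly B = P := by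
  obtain ⟨B, hB, hPB⟩ := exists_invariant_of_alternating P halt
  have hCB : IsConjInvariant fun z =>
      MvPolynomial.eval z (MvPolynomial.C (hcConst n : ℂ)⁻¹ * B) := fun u z => by
    simp only [map_mul, MvPolynomial.eval_C]
    exact congrArg _ (hB u z)
  have hpsi : psiPoly (MvPolynomial.C (hcConst n : ℂ)⁻¹ * B) = P := by
    rw [psiPoly, restrictDiag_mul, restrictDiag_C, mul_left_comm (vandermondePoly n),
      ← mul_assoc (MvPolynomial.C _) (MvPolynomial.C _), ← MvPolynomial.C_mul, mul_inv_cancel₀ (hcConst_ne_zero n), MvPolynomial.C_1, one_mul, hPB]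
  refine ⟨MvPolynomial.homogeneousComponent k (MvPolynomial.C (hcConst n : ℂ)⁻¹ * B),
    MvPolynomial.homogeneousComponent_isHomogeneous k _,
    isConjInvariant_homogeneousComponent hCB k, ?_⟩
  rw [← homogeneousComponent_psiPoly, hpsi]
  exact MvPolynomial.homogeneousComponent_eq_self hP

/-- A homogeneous alternating polynomial of degree lower than that of the Vandermonde product
vanishes. -/
theorem eq_zero_of_alternating_of_lt {n j : ℕ} {P : MvPolynomial (Fin n) ℂ}
    (hP : P.IsHomogeneous j) (hj : j < ∑ i : Fin n, (Finset.Ioi i).card)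
    (halt : ∀ σ : Equiv.Perm (Fin n), MvPolynomial.rename σ P =
      ((Equiv.Perm.sign σ : ℤ) : MvPolynomial (Fin n) ℂ) * P) : P = 0 := by
  by_contra hP0
  obtain ⟨Q, -, rfl⟩ := exists_symmetric_of_alternating P halt
  have h1 := hP.totalDegree hP0
  rw [MvPolynomial.totalDegree_mul_of_isDomain (left_ne_zero_of_mul hP0)
    (right_ne_zero_of_mul hP0),
    (isHomogeneous_vandermondePoly n).totalDegree (vandermondePoly_ne_zero n)] at h1
  omega

/-- Surjectivity: the preimages of the homogeneous components have the same norms, so they sum to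
an entire function. -/
theorem IsPsiIsometric.exists_psi_eq {n : ℕ} (hiso : IsPsiIsometric n)
    {A : (Fin n → ℂ) → ℂ} (hA : A ∈ alternatingSB n) : ∃ F ∈ invariantSB n, psi n F = A := by
  obtain ⟨hAs, hAalt⟩ := hA
  obtain ⟨hAd, hAn⟩ := (mem_segalBargmann_iff_sbNormSq A).mp hAs
  obtain ⟨P, hP, hsum⟩ := exists_homogeneous_expansion hAd
  set d := ∑ i : Fin n, (Finset.Ioi i).card with hd
  have halt : ∀ k, ∀ σ : Equiv.Perm (Fin n), MvPolynomial.rename σ (P k) =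
      ((Equiv.Perm.sign σ : ℤ) : MvPolynomial (Fin n) ℂ) * P k := by
    intro k σ
    refine MvPolynomial.funext fun x => ?_
    have h := eval_eq_of_hasSum_homogeneous hP hsum (L := fun z i => z (σ⁻¹ i))
      (fun _ _ => rfl) (hAalt σ) k (x ∘ σ)
    rw [MvPolynomial.eval_rename, h, map_mul, map_intCast]
    simp
  rw [sbNormSq_eq_tsum (d := 0) (fun k => by rw [zero_add]; exact hP k) hAd.continuous hsum] at hAn
  choose B hB hBi hBP using fun k => exists_psiPoly_eq_of_alternating (hP (d + k)) (halt (d + k))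
  have hnorm : ∀ k, fischerNormSq (B k) = fischerNormSq (P (d + k)) := fun k => by
    rw [← hiso.fischerNormSq_psiPoly (hBi k), hBP]
  have htsum : ∑' k, ENNReal.ofReal (fischerNormSq (B k)) ≤
      ∑' k, ENNReal.ofReal (fischerNormSq (P k)) := by
    simp only [hnorm]
    exact ENNReal.tsum_comp_le_tsum_of_injective (add_right_injective d) _
  obtain ⟨F, hFd, hFsum⟩ := exists_entire_hasSum hB
    (M := (∑' k, ENNReal.ofReal (fischerNormSq (P k))).toReal) fun k => by
      rw [← ENNReal.ofReal_le_iff_le_toReal hAn]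
      exact (ENNReal.le_tsum k).trans htsum
  have hFi : IsConjInvariant F := fun u z =>
    (hFsum z).unique ((hFsum _).congr_fun fun k => hBi k u z)
  refine ⟨F, (mem_invariantSB_iff F).mpr ⟨(mem_segalBargmann_iff_sbNormSq F).mpr ⟨hFd, ?_⟩, hFi⟩,
    funext fun x => ?_⟩
  · rw [sbNormSq_eq_tsum (d := 0) (fun k => by rw [zero_add]; exact hB k) hFd.continuous hFsum]
    exact ne_top_of_le_ne_top hAn htsum
  · have h1 := (hasSum_nat_add_iff' d).mpr (hsum x)
    rw [Finset.sum_eq_zero fun j hj => by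
      rw [eq_zero_of_alternating_of_lt (hP j) (Finset.mem_range.mp hj) (halt j), map_zero],
      sub_zero] at h1
    refine (hasSum_psi hFsum x).unique (h1.congr_fun fun k => ?_)
    rw [hBP, add_comm]

theorem IsPsiIsometric.isUnitaryBetween {n : ℕ} (hiso : IsPsiIsometric n) :
    IsUnitaryBetween (psi n) (invariantSB n) (alternatingSB n) := by
  refine ⟨⟨fun F hF => hiso.mapsTo_psi hF, fun F hF G hG h => ?_, fun A hA => ?_⟩,
    fun F hF G hG => hiso.sbInner_psi hF hG⟩
  · have hFG := (invariantSB n).sub_mem hF hG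
    refine sub_eq_zero.mp (hiso.eq_zero_of_psi_eq_zero hFG.1.1
      ((mem_invariantSB_iff _).mp hFG).2 ?_)
    rw [map_sub, sub_eq_zero]
    exact h
  · obtain ⟨F, hF, h⟩ := hiso.exists_psi_eq hA
    exact ⟨F, hF, h⟩

theorem isPsiIsometric_of_isUnitaryBetween {n : ℕ}
    (h : IsUnitaryBetween (psi n) (invariantSB n) (alternatingSB n)) : IsPsiIsometric n := by
  intro A B hA hB
  have h1 := h.2 _ ((isInvariantPoly_iff A).mpr hA) _ ((isInvariantPoly_iff B).mpr hB)
  rw [sbInner_eval] at h1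
  rw [← h1, ← sbInner_eval]
  congr 1 <;> exact funext fun x => (psi_eval_apply _ x).symm

end

theorem mainTheorem3 (n : ℕ) :
    IsUnitaryBetween (psi n) (invariantSB n) (alternatingSB n) ↔
      ∀ F G : MvPolynomial (Fin n × Fin n) ℂ, IsInvariantPoly F → IsInvariantPoly G →
        ∀ x : Fin n → ℂ,
          vandermondeProd x *
              MvPolynomial.eval (entries (Matrix.diagonal x)) (diffOp F G) =
            MvPolynomial.eval x
              (diffOp (restrictDiag F)
                (vandermondeProd (fun i => (MvPolynomial.X i : MvPolynomial (Fin n) ℂ)) *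
                  restrictDiag G)) := by
  constructor
  · intro h F G hF hG x
    rw [← diffOp_identity_of_isometry (isPsiIsometric_of_isUnitaryBetween h)
      ((isInvariantPoly_iff F).mp hF) ((isInvariantPoly_iff G).mp hG), map_mul,
      eval_vandermondePoly, eval_restrictDiag]
  · intro h
    refine (isometry_of_diffOp_identity fun A B hA hB =>
      MvPolynomial.funext fun x => ?_).isUnitaryBetween
    rw [← h A B ((isInvariantPoly_iff A).mpr hA) ((isInvariantPoly_iff B).mpr hB) x, map_mul,
      eval_vandermondePoly, eval_restrictDiag]
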